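/- For a Boolean function $f:\mathbb{Z}_2^n\to\mathbb{Z}_2$ put $\widehat f(w)=2^{-n}\sum_x(-1)^{wx^t+f(x)}$. The function $f$ is bent if $|\widehat f(w)|=2^{-n/2}$ for all $w$; its dual $\widetilde f$ is then defined by $(-1)^{\widetilde f(w)}=2^{n/2}\widehat f(w)$. Let $n=2m$ with $m\ge 1$. A Maiorana–McFarland function is a function $f(x,y)=x\,\pi(y)^t+h(y)$ on $\mathbb{Z}_2^m\times\mathbb{Z}_2^m=\mathbb{Z}_2^n$, where $\pi$ is a permutation of $\mathbb{Z}_2^m$ and $h:\mathbb{Z}_2^m\to\mathbb{Z}_2$ is arbitrary. For $s\in\mathbb{Z}_2^n$ let $\mathcal{O}_{f,\widetilde f}$ be the oracle that gives access to the values of $f$, of $g(x)=f(x+s)$ and of $\widetilde f$. Here $f$ is fixed and the shift $s$ is unknown and has to be found; each query returns one bit. The recursive oracle $\mathcal{O}_{rec}$ of height $\ell$ is defined as follows. At height $0$ it is $\mathcal{O}_{f,\widetilde f}$ for a hidden shift $s$. At height $\ell+1$ it has a root with a hidden shift $s$ and, for every $x\in\mathbb{Z}_2^n$, an arbitrary instance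 of height $\ell$. It gives access to $f$, to $\widetilde f$ and to the oracles of all these smaller instances. On a pair $(x,t)$ it calls the oracle $\mathcal{O}_{f,\widetilde f}$ of the root and returns $g(x)=f(x+s)$ if $t$ is the root shift of the smaller instance belonging to $x$, and it returns $0$ otherwise. The task is to find the shift at the root. **Theorem.** (1) $\Theta(n)$ classical queries are necessary and sufficient to identify $s$ from $\mathcal{O}_{f,\widetilde f}$. More precisely, there are constants $c,C>0$ such that for all $m\ge1$: (a) for every Maiorana–McFarland function $f$ of $n=2m$ variables, every randomized classical algorithm (which may depend on $f$) that identifies every $s$ with probability at least $2/3$ makes at least $cn$ queries in the worst case; (b) there is a deterministic adaptive algorithm, depending on $f$ only through the points $\pi^{-1}(e_1),\dots,\pi^{-1}(e_m)$ with $e_i$ the standard basis vectors, that identifies every $s$ with at most $Cn$ queries. (2) For the recursive oracle $\mathcal{O}_{rec}$ of height $\lfloor\log_2 n\rfloor$ there are constants $k,C$ such that for all $m\ge1$: (a) some quantum algorithm with at most $n^k$ queries finds the shift at the root with probability $1$, for all Maiorana–McFarland functions $f$ of $n=2m$ variables and all hidden shifts; (b) for every Maiorana–McFarland function $f$ of $n=2m$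 variables, every randomized classical algorithm (which may depend on $f$) that finds the shift at the root with probability at least $2/3$ on all instances makes at least $n^{\log_2 n-C}$ queries in the worst case, and some deterministic classical algorithm (which may depend on $f$) finds it on all instances with at most $n^{\log_2 n+C}$ queries. So the classical query complexity is superpolynomial, $n^{\log_2 n\pm O(1)}$, while the quantum query complexity is polynomial. -/

import Mathlib

open scoped Matrix

noncomputable section

/-! ## Boolean functions, bent functions and their duals -/

/-- The vectors of bits indexed by `ι`, the group `ℤ₂^ι`. -/
abbrev Cube (ι : Type) : Type := ι → ZMod 2

/-- The real sign `(-1)^b` of a bit `b`. -/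
def bitSign (b : ZMod 2) : ℝ := (-1) ^ b.val

/-- Fourier coefficient `f̂(w) = 2⁻ⁿ ∑ₓ (-1)^(w xᵗ + f(x))` of a Boolean function of `n = |ι|`
variables. -/
def walshCoeff {ι : Type} [Fintype ι] [DecidableEq ι]
    (f : Cube ι → ZMod 2) (w : Cube ι) : ℝ :=
  (1 / 2 ^ Fintype.card ι) * ∑ x : Cube ι, bitSign (w ⬝ᵥ x + f x)

/-- `f` is bent: all Fourier coefficients have absolute value `2^(-n/2)`. -/
def IsBent {ι : Type} [Fintype ι] [DecidableEq ι] (f : Cube ι → ZMod 2) : Prop :=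
  ∀ w, |walshCoeff f w| = (2 : ℝ) ^ (-(Fintype.card ι : ℝ) / 2)

/-- `f` is bent and `fd` is its dual bent function: `2^(n/2) f̂(w) = (-1)^(fd(w))`. -/
def IsBentWithDual {ι : Type} [Fintype ι] [DecidableEq ι]
    (f fd : Cube ι → ZMod 2) : Prop :=
  IsBent f ∧ ∀ w, (2 : ℝ) ^ ((Fintype.card ι : ℝ) / 2) * walshCoeff f w = bitSign (fd w)

/-- The group `ℤ₂^m × ℤ₂^m = ℤ₂^(2m)`; its elements `(x, y)` are `Sum.elim x y`. -/
abbrev DoubleCube (m : ℕ) : Type := Cube (Fin m ⊕ Fin m)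

/-- The Maiorana–McFarland function `(x, y) ↦ x π(y)ᵗ + h(y)` of `2m` variables. -/
def maioranaMcFarland {m : ℕ} (π : Equiv.Perm (Cube (Fin m))) (h : Cube (Fin m) → ZMod 2)
    (z : DoubleCube m) : ZMod 2 :=
  (fun i => z (Sum.inl i)) ⬝ᵥ π (fun i => z (Sum.inr i)) + h (fun i => z (Sum.inr i))

/-- `f` belongs to the Maiorana–McFarland class. -/
def IsMaioranaMcFarland {m : ℕ} (f : DoubleCube m → ZMod 2) : Prop :=
  ∃ (π : Equiv.Perm (Cube (Fin m))) (h : Cube (Fin m) → ZMod 2), f = maioranaMcFarland π h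

/-! ## The hidden shift oracle and the recursive oracle -/

/-- The queries to a hidden shift oracle: the value at `x` of the function `f`, of the shifted
function `g`, or of the dual function. -/
inductive ShiftQuery (V : Type) : Type
  | base (x : V)
  | shifted (x : V)
  | dual (x : V)
  deriving DecidableEq, Fintype

/-- The oracle that gives access to `f`, to `g(x) = f(x + s)` and to `fd`. -/
def shiftOracle {V : Type} [Add V] (f fd : V → ZMod 2) (s : V) : ShiftQuery V → ZMod 2
  | .base x => f x
  | .shifted x => f (x + s)
  | .dual x => fd x

/-- The hidden data of a recursive instance of height `ℓ`: a shift at the root and, if the height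
is positive, an instance of height `ℓ - 1` for every `x`. -/
def ShiftTree (V : Type) : ℕ → Type
  | 0 => V
  | ℓ + 1 => V × (V → ShiftTree V ℓ)

/-- The hidden shift at the root. -/
def ShiftTree.root {V : Type} : (ℓ : ℕ) → ShiftTree V ℓ → V
  | 0, s => s
  | _ + 1, S => S.1

/-- The queries to the recursive oracle of height `ℓ`. At positive height these are: a query
`q` to the hidden shift oracle at the root, accompanied by a key; or a query to the instance of
height `ℓ - 1` that belongs to `x`. -/
def RecQuery (V : Type) : ℕ → Type
  | 0 => ShiftQuery V
  | ℓ + 1 => (ShiftQuery V × V) ⊕ (V × RecQuery V ℓ)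

instance RecQuery.instFintype {V : Type} [Fintype V] : (ℓ : ℕ) → Fintype (RecQuery V ℓ)
  | 0 => inferInstanceAs (Fintype (ShiftQuery V))
  | ℓ + 1 =>
    haveI := RecQuery.instFintype (V := V) ℓ
    inferInstanceAs (Fintype ((ShiftQuery V × V) ⊕ (V × RecQuery V ℓ)))

instance RecQuery.instDecidableEq {V : Type} [DecidableEq V] :
    (ℓ : ℕ) → DecidableEq (RecQuery V ℓ)
  | 0 => inferInstanceAs (DecidableEq (ShiftQuery V))
  | ℓ + 1 =>
    haveI := RecQuery.instDecidableEq (V := V) ℓ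
    inferInstanceAs (DecidableEq ((ShiftQuery V × V) ⊕ (V × RecQuery V ℓ)))

/-- The recursive oracle. At height `0` it is the hidden shift oracle. At positive height, it
answers the query for `g(x)` at the root by a call to the hidden shift oracle of the root,
provided that the key is the solution (the root shift) of the smaller instance that belongs
to `x`; with any other key the answer is `0`. Queries for `f` and for the dual function are
answered whatever the key, and queries to a smaller instance are answered by its oracle. -/
def recOracle {V : Type} [Add V] [DecidableEq V] (f fd : V → ZMod 2) :
    (ℓ : ℕ) → ShiftTree V ℓ → RecQuery V ℓ → ZMod 2
  | 0, s, q => shiftOracle f fd s q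
  | ℓ + 1, S, .inl (.shifted x, key) =>
      if key = ShiftTree.root ℓ (S.2 x) then shiftOracle f fd S.1 (.shifted x) else 0
  | _ + 1, S, .inl (.base x, _) => shiftOracle f fd S.1 (.base x)
  | _ + 1, S, .inl (.dual x, _) => shiftOracle f fd S.1 (.dual x)
  | ℓ + 1, S, .inr (x, q) => recOracle f fd ℓ (S.2 x) q

/-! ## Classical query algorithms -/

/-- Deterministic adaptive query algorithms: decision trees that ask queries in `Q`, receive
bits and output an element of `R`. -/
inductive DecisionTree (Q R : Type) : Type
  | output (r : R)
  | query (q : Q) (next : ZMod 2 → DecisionTree Q R)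

/-- The output of the algorithm when it runs with the oracle `O`. -/
def DecisionTree.eval {Q R : Type} : DecisionTree Q R → (Q → ZMod 2) → R
  | .output r, _ => r
  | .query q next, O => (next (O q)).eval O

/-- The number of queries that the algorithm makes when it runs with the oracle `O`. -/
def DecisionTree.cost {Q R : Type} : DecisionTree Q R → (Q → ZMod 2) → ℕ
  | .output _, _ => 0
  | .query q next, O => (next (O q)).cost O + 1

/-- The deterministic algorithm `t` outputs `answer i` on every instance `i`, with at most `T`
queries to the oracle `oracle i`. -/
def DecisionTree.Solves {I Q R : Type} (t : DecisionTree Q R) (oracle : I → Q → ZMod 2)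
    (answer : I → R) (T : ℕ) : Prop :=
  ∀ i, t.eval (oracle i) = answer i ∧ t.cost (oracle i) ≤ T

/-- The randomized algorithm `μ`, a random decision tree, always makes at most `T` queries and on
every instance `i` outputs `answer i` with probability at least `2/3`. -/
def RandomizedSolves {I Q R : Type} (μ : PMF (DecisionTree Q R)) (oracle : I → Q → ZMod 2)
    (answer : I → R) (T : ℕ) : Prop :=
  (∀ t ∈ μ.support, ∀ i, t.cost (oracle i) ≤ T) ∧
    ∀ i, 2 / 3 ≤ (μ.map fun t => t.eval (oracle i)) (answer i)

/-! ## Quantum query algorithms -/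

/-- Quantum query algorithms. The basis states are `|q, b, w⟩` with a query register `q`, an answer
bit `b` and a workspace `w`. The algorithm starts in a basis state, applies
`unitary 0, oracle, unitary 1, oracle, …, oracle, unitary queries`, measures in the standard basis
and reads its output off the result of the measurement. -/
structure QuantumAlgorithm (Q R : Type) [Fintype Q] [DecidableEq Q] where
  Work : Type
  [fintypeWork : Fintype Work]
  [decidableEqWork : DecidableEq Work]
  queries : ℕ
  start : Q × ZMod 2 × Work
  unitary : ℕ → Matrix.unitaryGroup (Q × ZMod 2 × Work) ℂ
  out : Q × ZMod 2 × Work → R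

attribute [instance] QuantumAlgorithm.fintypeWork QuantumAlgorithm.decidableEqWork

/-- One oracle call, the unitary `|q, b, w⟩ ↦ |q, b + O(q), w⟩`, applied to the vector `ψ` of
amplitudes. -/
def oracleCall {Q W : Type} (O : Q → ZMod 2) (ψ : Q × ZMod 2 × W → ℂ) : Q × ZMod 2 × W → ℂ :=
  fun z => ψ (z.1, z.2.1 - O z.1, z.2.2)

/-- The state after `k` oracle calls and the unitary that follows. -/
def QuantumAlgorithm.state {Q R : Type} [Fintype Q] [DecidableEq Q] (A : QuantumAlgorithm Q R)
    (O : Q → ZMod 2) : ℕ → (Q × ZMod 2 × A.Work → ℂ)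
  | 0 => (A.unitary 0).1 *ᵥ Pi.single A.start 1
  | k + 1 => (A.unitary (k + 1)).1 *ᵥ oracleCall O (A.state O k)

/-- The probability of the output `r` when the algorithm runs with the oracle `O`. -/
def QuantumAlgorithm.prob {Q R : Type} [Fintype Q] [DecidableEq Q] [DecidableEq R]
    (A : QuantumAlgorithm Q R) (O : Q → ZMod 2) (r : R) : ℝ :=
  ∑ z, if A.out z = r then ‖A.state O A.queries z‖ ^ 2 else 0

end

open scoped Matrix Kronecker

noncomputable section

/-! ## Signs, characters and the dual of a Maiorana–McFarland function -/

/-! Upper bounds. The dual of $x\,\pi(y)^t+h(y)$ is $\tilde f(u,v)=v\,\pi^{-1}(u)^t+h(\pi^{-1}(u))$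
(`dual_maioranaMcFarland`). For the shift $(x,y)$, differences of $g$ in the directions $(e_i,0)$
give $\pi(y)$, differences of $\tilde f(\pi(y),\cdot)$ give $y$, and comparing $g$ with $f$ at the
points $\pi^{-1}(e_i)$ gives $x$: $6m$ queries (`findShift_solves`). On the recursive oracle each
query to $g$ costs one recursive call for its key, so the cost grows by a factor $O(n)$ per level
(`findRoot_solves`). The quantum algorithm needs one phase query to $g$ and one to $\tilde f$;
computing and uncomputing the key makes two recursive calls, so the cost only about doubles per
level and is polynomial at logarithmic height (`exists_root_circuit`).

Lower bounds. By averaging, some single decision tree is right on two thirds of all instances. Score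
it $a^c$ on an instance where it finds the root after $c$ moves. With $a_\ell=2^{-1/m^\ell}$ the
mean score at height $\ell$ is at most $a_\ell/((1-a_\ell)2^{2m})$ (`sum_hit_le`). Finding the root
within $T$ moves then forces $2^{T/m^\ell}$ to be at least of order $2^{2m}/m^\ell$, hence $T\ge
m^{\ell+1}$ once $2^m$ beats the polynomial factors.

The bound is proved by induction on the height. Height $0$ is Kraft's inequality. At positive height
the only information on the root shift comes from right keys. Each releases one bit, which at most
doubles the total score. So a smaller instance becomes a game in which solving it pays a factor $2$
(`bonus`), and the values of these games multiply over $x$ (`sum_hit_recOracle_le`). With the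
discount $a=a_{\ell+1}$ the factor $2$ is profitable only after fewer than $m^{\ell+1}$ moves. Since
$a^m=a_\ell$, the induction hypothesis makes so early a success exponentially rare. Hence no
strategy beats stopping at once (`value_univ_le`), and the smaller instances contribute nothing to
the bound at the root. -/

lemma bitSign_zero : bitSign 0 = 1 := by simp [bitSign]

lemma bitSign_one : bitSign 1 = -1 := by simp [bitSign, ZMod.val_one]

lemma ZMod.two_cases (a : ZMod 2) : a = 0 ∨ a = 1 := by
  revert a; decide

lemma bitSign_add (a b : ZMod 2) : bitSign (a + b) = bitSign a * bitSign b := by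
  have h : (1 + 1 : ZMod 2) = 0 := by decide
  rcases ZMod.two_cases a with rfl | rfl <;> rcases ZMod.two_cases b with rfl | rfl <;>
    simp [bitSign_zero, bitSign_one, h]

lemma bitSign_mul_self (a : ZMod 2) : bitSign a * bitSign a = 1 := by
  rw [← bitSign_add, CharTwo.add_self_eq_zero, bitSign_zero]

lemma bitSign_injective : Function.Injective bitSign := by
  intro a b h
  rcases ZMod.two_cases a with rfl | rfl <;> rcases ZMod.two_cases b with rfl | rfl <;>
    first | rfl | norm_num [bitSign_zero, bitSign_one] at h

lemma cube_add_eq_zero {ι : Type} {x y : Cube ι} : x + y = 0 ↔ x = y := by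
  simp only [funext_iff, Pi.add_apply, Pi.zero_apply, CharTwo.add_eq_zero]

section Characters

variable {ι : Type} [Fintype ι] [DecidableEq ι]

lemma card_cube : Fintype.card (Cube ι) = 2 ^ Fintype.card ι := by
  simp [ZMod.card]

/-- Orthogonality of the characters of the cube. -/
lemma sum_bitSign_dotProduct (w : Cube ι) :
    ∑ x : Cube ι, bitSign (w ⬝ᵥ x) = if w = 0 then (2 : ℝ) ^ Fintype.card ι else 0 := by
  split_ifs with hw
  · subst hw
    simp [bitSign_zero, ZMod.card]
  · obtain ⟨i, hi⟩ : ∃ i, w i ≠ 0 := by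
      by_contra! h
      exact hw (funext h)
    have hi : w i = 1 := (ZMod.two_cases _).resolve_left hi
    have h := Equiv.sum_comp (Equiv.addRight (Pi.single i 1 : Cube ι))
      (fun x : Cube ι => bitSign (w ⬝ᵥ x))
    simp only [Equiv.coe_addRight, dotProduct_add, dotProduct_single, hi, mul_one, bitSign_add,
      bitSign_one, mul_neg, Finset.sum_neg_distrib] at h
    linarith

lemma walshCoeff_of_dual {f fd : Cube ι → ZMod 2} (h : IsBentWithDual f fd) {k : ℕ}
    (hk : Fintype.card ι = 2 * k) (w : Cube ι) :
    (2 : ℝ) ^ k * walshCoeff f w = bitSign (fd w) := by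
  rw [← h.2 w, hk]
  congr 1
  rw [← Real.rpow_natCast]
  congr 1
  push_cast
  ring

end Characters

lemma sum_doubleCube {m : ℕ} (F : DoubleCube m → ℝ) :
    ∑ z, F z = ∑ y : Cube (Fin m), ∑ x : Cube (Fin m), F (Sum.elim x y) := by
  rw [Finset.sum_comm, ← Fintype.sum_prod_type',
    ← Equiv.sum_comp (Equiv.sumArrowEquivProdArrow (Fin m) (Fin m) (ZMod 2)).symm]
  rfl

lemma maioranaMcFarland_elim {m : ℕ} (π : Equiv.Perm (Cube (Fin m))) (h : Cube (Fin m) → ZMod 2)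
    (x y : Cube (Fin m)) : maioranaMcFarland π h (Sum.elim x y) = x ⬝ᵥ π y + h y := rfl

/-- For fixed $y$ the function is affine in $x$, so summing over $x$ first leaves only the $y$ with
$\pi(y)=u$. -/
lemma dual_maioranaMcFarland {m : ℕ} {π : Equiv.Perm (Cube (Fin m))} {h : Cube (Fin m) → ZMod 2}
    {fd : DoubleCube m → ZMod 2} (hfd : IsBentWithDual (maioranaMcFarland π h) fd)
    (u v : Cube (Fin m)) :
    fd (Sum.elim u v) = v ⬝ᵥ π.symm u + h (π.symm u) := by
  apply bitSign_injective
  rw [← walshCoeff_of_dual hfd (k := m) (by simp; ring), walshCoeff, sum_doubleCube]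
  have h1 : ∀ x y : Cube (Fin m),
      bitSign (Sum.elim u v ⬝ᵥ Sum.elim x y + maioranaMcFarland π h (Sum.elim x y)) =
        bitSign (v ⬝ᵥ y + h y) * bitSign ((u + π y) ⬝ᵥ x) := by
    intro x y
    rw [← bitSign_add, maioranaMcFarland_elim, sumElim_dotProduct_sumElim, add_dotProduct,
      dotProduct_comm x (π y)]
    congr 1
    ring
  have h2 : ∀ y : Cube (Fin m), u + π y = 0 ↔ y = π.symm u := by
    intro y
    rw [Equiv.eq_symm_apply, cube_add_eq_zero, eq_comm]
  simp only [h1, ← Finset.mul_sum, sum_bitSign_dotProduct, h2, mul_ite, mul_zero,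
    Finset.sum_ite_eq', Finset.mem_univ, if_true, Fintype.card_sum, Fintype.card_fin]
  have : (2 : ℝ) ^ m ≠ 0 := by positivity
  rw [pow_add]
  field_simp

/-! ## Operations on decision trees -/

namespace DecisionTree

variable {Q Q' R R' : Type}

/-- Run `t`, then the tree that belongs to its output. -/
def bind : DecisionTree Q R → (R → DecisionTree Q R') → DecisionTree Q R'
  | output r, k => k r
  | query q next, k => query q fun b => (next b).bind k

lemma eval_bind (t : DecisionTree Q R) (k : R → DecisionTree Q R') (O : Q → ZMod 2) :
    (t.bind k).eval O = (k (t.eval O)).eval O := by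
  induction t with
  | output r => rfl
  | query q next ih => exact ih _

lemma cost_bind (t : DecisionTree Q R) (k : R → DecisionTree Q R') (O : Q → ZMod 2) :
    (t.bind k).cost O = t.cost O + (k (t.eval O)).cost O := by
  induction t with
  | output r => simp [bind, cost, eval]
  | query q next ih =>
    simp only [bind, cost, eval, ih]
    ring

/-- Replace every query of `t` by a subroutine that returns a bit. -/
def subst (σ : Q → DecisionTree Q' (ZMod 2)) : DecisionTree Q R → DecisionTree Q' R
  | output r => output r
  | query q next => (σ q).bind fun b => (next b).subst σ

lemma eval_subst (σ : Q → DecisionTree Q' (ZMod 2)) (t : DecisionTree Q R) (O : Q' → ZMod 2) :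
    (t.subst σ).eval O = t.eval fun q => (σ q).eval O := by
  induction t with
  | output r => rfl
  | query q next ih => rw [subst, eval_bind, ih, eval]

lemma cost_subst_le (σ : Q → DecisionTree Q' (ZMod 2)) (t : DecisionTree Q R) (O : Q' → ZMod 2)
    {c : ℕ} (hc : ∀ q, (σ q).cost O ≤ c) :
    (t.subst σ).cost O ≤ (t.cost fun q => (σ q).eval O) * c := by
  induction t with
  | output r => simp [subst, cost]
  | query q next ih =>
    rw [subst, cost_bind, cost, add_mul, one_mul, add_comm]
    exact add_le_add (ih _) (hc q)

/-- Ask the single query `q` and return the answer. -/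
def ask (q : Q) : DecisionTree Q (ZMod 2) := query q output

/-- Ask the queries `q 0, …, q (k - 1)` and `q' 0, …, q' (k - 1)` and return the sums of the
corresponding answers. -/
def askSums : (k : ℕ) → (Fin k → Q) → (Fin k → Q) → DecisionTree Q (Fin k → ZMod 2)
  | 0, _, _ => output Fin.elim0
  | k + 1, q, q' => query (q 0) fun a => query (q' 0) fun b =>
      (askSums k (q ∘ Fin.succ) (q' ∘ Fin.succ)).bind fun c => output (Fin.cons (a + b) c)

lemma eval_askSums (O : Q → ZMod 2) : ∀ (k : ℕ) (q q' : Fin k → Q),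
    (askSums k q q').eval O = fun i => O (q i) + O (q' i)
  | 0, q, q' => Subsingleton.elim _ _
  | k + 1, q, q' => by
    simp only [askSums, eval, eval_bind, eval_askSums O k]
    funext i
    refine Fin.cases ?_ (fun i => ?_) i <;> simp

lemma cost_askSums (O : Q → ZMod 2) : ∀ (k : ℕ) (q q' : Fin k → Q),
    (askSums k q q').cost O = 2 * k
  | 0, q, q' => rfl
  | k + 1, q, q' => by
    simp only [askSums, cost, cost_bind, cost_askSums O k]
    ring

end DecisionTree

/-! ## Classical algorithms -/

section Algorithms

open DecisionTree

variable {m : ℕ}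

/-- The algorithm that finds the hidden shift `(x, y)` of a Maiorana–McFarland function with
`π (b i) = e i`: it learns `π y`, then `y` from the dual function, and then `x`. -/
def findShift (b : Fin m → Cube (Fin m)) :
    DecisionTree (ShiftQuery (DoubleCube m)) (DoubleCube m) :=
  (askSums m (fun i => .shifted (Sum.elim (Pi.single i 1) 0))
      (fun _ => .shifted (Sum.elim 0 0))).bind
    fun u => (askSums m (fun i => .dual (Sum.elim u (Pi.single i 1)))
      (fun _ => .dual (Sum.elim u 0))).bind
    fun y => (askSums m (fun i => .shifted (Sum.elim 0 (b i + y)))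
      (fun i => .base (Sum.elim 0 (b i)))).bind
    fun x => output (Sum.elim x y)

lemma findShift_solves {b : Fin m → Cube (Fin m)} {π : Equiv.Perm (Cube (Fin m))}
    {h : Cube (Fin m) → ZMod 2} {fd : DoubleCube m → ZMod 2}
    (hb : ∀ i, π.symm (Pi.single i 1) = b i) (hfd : IsBentWithDual (maioranaMcFarland π h) fd) :
    (findShift b).Solves (fun s => shiftOracle (maioranaMcFarland π h) fd s) (fun s => s)
      (6 * m) := by
  intro s
  obtain ⟨x, y, rfl⟩ : ∃ x y : Cube (Fin m), s = Sum.elim x y :=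
    ⟨s ∘ Sum.inl, s ∘ Sum.inr, (Sum.elim_comp_inl_inr s).symm⟩
  have hadd : ∀ a c a' c' : Cube (Fin m),
      (Sum.elim a c + Sum.elim a' c' : DoubleCube m) = Sum.elim (a + a') (c + c') := by
    intro a c a' c'
    ext i
    cases i <;> rfl
  constructor
  · have h1 : ∀ i, shiftOracle (maioranaMcFarland π h) fd (Sum.elim x y)
          (.shifted (Sum.elim (Pi.single i 1) 0)) +
        shiftOracle (maioranaMcFarland π h) fd (Sum.elim x y) (.shifted (Sum.elim 0 0)) =
        π y i := by
      intro i
      simp only [shiftOracle, hadd, maioranaMcFarland_elim, zero_add, add_dotProduct,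
        single_dotProduct, one_mul]
      -- The two values share the term $f(x,y)$, which cancels in characteristic two.
      linear_combination (x ⬝ᵥ π y + h y) * (CharTwo.two_eq_zero : (2 : ZMod 2) = 0)
    have h2 : ∀ i, shiftOracle (maioranaMcFarland π h) fd (Sum.elim x y)
          (.dual (Sum.elim (π y) (Pi.single i 1))) +
        shiftOracle (maioranaMcFarland π h) fd (Sum.elim x y) (.dual (Sum.elim (π y) 0)) =
        y i := by
      intro i
      simp only [shiftOracle, dual_maioranaMcFarland hfd, Equiv.symm_apply_apply,
        zero_dotProduct, single_dotProduct, one_mul, zero_add]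
      linear_combination (h y) * (CharTwo.two_eq_zero : (2 : ZMod 2) = 0)
    have h3 : ∀ i, shiftOracle (maioranaMcFarland π h) fd (Sum.elim x y)
          (.shifted (Sum.elim 0 (b i + y))) +
        shiftOracle (maioranaMcFarland π h) fd (Sum.elim x y) (.base (Sum.elim 0 (b i))) =
        x i := by
      intro i
      have hπ : π (b i) = Pi.single i 1 := by rw [← hb, Equiv.apply_symm_apply]
      simp only [shiftOracle, hadd, maioranaMcFarland_elim, zero_add, add_assoc,
        cube_add_eq_zero.2 rfl, add_zero, hπ, dotProduct_single, mul_one,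
        Pi.zero_apply, CharTwo.add_self_eq_zero]
    simp only [findShift, eval_bind, eval_askSums, h1, h2, h3, eval]
  · simp only [findShift, cost_bind, cost_askSums, cost]
    omega

variable {V : Type} [AddCommGroup V] [DecidableEq V]

/-- The recursive classical algorithm: `t` with every query to the shifted function preceded by
a recursive computation of its key. -/
def findRoot (t : DecisionTree (ShiftQuery V) V) : (ℓ : ℕ) → DecisionTree (RecQuery V ℓ) V
  | 0 => t
  | ℓ + 1 => t.subst fun
    | .base x => ask (Q := RecQuery V (ℓ + 1)) (.inl (.base x, 0))
    | .dual x => ask (Q := RecQuery V (ℓ + 1)) (.inl (.dual x, 0))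
    | .shifted x =>
        ((findRoot t ℓ).subst fun q => ask (Q := RecQuery V (ℓ + 1)) (.inr (x, q))).bind
          fun key => ask (.inl (.shifted x, key))

/-- Each of the at most $T$ simulated queries costs at most one recursive run and one query more.
The base $2T$ absorbs this extra query. -/
lemma findRoot_solves {f fd : V → ZMod 2} {t : DecisionTree (ShiftQuery V) V} {T : ℕ}
    (hT : 1 ≤ T) (ht : t.Solves (fun s => shiftOracle f fd s) (fun s => s) T) (ℓ : ℕ) :
    (findRoot t ℓ).Solves (recOracle f fd ℓ) (ShiftTree.root ℓ) ((2 * T) ^ (ℓ + 1)) := by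
  induction ℓ with
  | zero => exact fun s => ⟨(ht s).1, (ht s).2.trans (by simp; omega)⟩
  | succ ℓ ih =>
    rintro ⟨s, S⟩
    have key : ∀ x, (((findRoot t ℓ).subst
        fun q => ask (Q := RecQuery V (ℓ + 1)) (.inr (x, q))).eval
          (recOracle f fd (ℓ + 1) (s, S))) = ShiftTree.root ℓ (S x) := by
      intro x
      rw [eval_subst]
      exact (ih (S x)).1
    constructor
    · rw [findRoot, eval_subst]
      refine Eq.trans ?_ (ht s).1
      congr 1
      funext q
      cases q with
      | base x => rfl
      | dual x => rfl
      | shifted x =>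
        simp only [eval_bind, key]
        exact if_pos rfl
    · have hpos : 1 ≤ (2 * T) ^ (ℓ + 1) := Nat.one_le_pow _ _ (by omega)
      rw [findRoot]
      refine (cost_subst_le _ t _ (c := (2 * T) ^ (ℓ + 1) + 1) ?_).trans ?_
      · intro q
        cases q with
        | base x => exact Nat.le_add_left _ _
        | dual x => exact Nat.le_add_left _ _
        | shifted x =>
          simp only [cost_bind]
          refine add_le_add ((cost_subst_le _ _ _ (c := 1) fun _ => le_rfl).trans ?_) le_rfl
          rw [mul_one]
          exact (ih (S x)).2
      -- The bound $T$ is known only on genuine shift oracles, so the subroutines must be seen to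
      -- simulate exactly such an oracle.
      · have hc : (t.cost fun q => DecisionTree.eval (match q with
            | .base x => ask (Q := RecQuery V (ℓ + 1)) (.inl (.base x, 0))
            | .dual x => ask (Q := RecQuery V (ℓ + 1)) (.inl (.dual x, 0))
            | .shifted x =>
              ((findRoot t ℓ).subst fun q => ask (Q := RecQuery V (ℓ + 1)) (.inr (x, q))).bind
                fun key => ask (.inl (.shifted x, key))) (recOracle f fd (ℓ + 1) (s, S))) ≤ T := by
          refine le_trans (le_of_eq ?_) (ht s).2
          congr 1
          funext q
          cases q with
          | base x => rfl
          | dual x => rfl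
          | shifted x =>
            simp only [eval_bind, key]
            exact if_pos rfl
        refine (Nat.mul_le_mul_right _ hc).trans ?_
        calc T * ((2 * T) ^ (ℓ + 1) + 1) ≤ T * (2 * (2 * T) ^ (ℓ + 1)) :=
              Nat.mul_le_mul_left _ (by omega)
          _ = (2 * T) ^ (ℓ + 1 + 1) := by ring

end Algorithms

/-! ## Search games -/

/-- Strategies in the game of finding an element of `R` with queries in `Q`. A guess is confirmed
if it is right, and then the game is over. -/
inductive GuessTree (Q R : Type) : Type
  | halt
  | query (q : Q) (next : ZMod 2 → GuessTree Q R)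
  | guess (r : R) (next : GuessTree Q R)

namespace GuessTree

variable {Q R I : Type} [DecidableEq R]

/-- The score `a ^ c` if the strategy finds `r` after `c` queries and guesses, and `0` if it
does not find `r`. -/
def hit (a : ℝ) : GuessTree Q R → (Q → ZMod 2) → R → ℝ
  | halt, _, _ => 0
  | query q next, O, r => a * (next (O q)).hit a O r
  | guess k next, O, r => a * if k = r then 1 else next.hit a O r

/-- The score `2 * a ^ c` if the strategy finds `r` after `c` queries and guesses, and `a ^ c` if
it stops after `c` queries and guesses without having found `r`. -/
def bonus (a : ℝ) : GuessTree Q R → (Q → ZMod 2) → R → ℝ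
  | halt, _, _ => 1
  | query q next, O, r => a * (next (O q)).bonus a O r
  | guess k next, O, r => a * if k = r then 2 else next.bonus a O r

lemma hit_query {a : ℝ} {q : Q} {next : ZMod 2 → GuessTree Q R} {O : Q → ZMod 2} {r : R}
    {v : ZMod 2} (h : O q = v) : (query q next).hit a O r = a * (next v).hit a O r := by
  rw [hit, h]

lemma hit_nonneg {a : ℝ} (ha : 0 ≤ a) (t : GuessTree Q R) (O : Q → ZMod 2) (r : R) :
    0 ≤ t.hit a O r := by
  induction t with
  | halt => exact le_rfl
  | query q next ih => exact mul_nonneg ha (ih _)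
  | guess k next ih =>
    refine mul_nonneg ha ?_
    split_ifs
    exacts [zero_le_one, ih]

lemma bonus_le_two {a : ℝ} (ha : 0 ≤ a) (ha1 : a ≤ 1) (t : GuessTree Q R) (O : Q → ZMod 2)
    (r : R) : t.bonus a O r ≤ 2 := by
  have key : ∀ x : ℝ, x ≤ 2 → a * x ≤ 2 := by
    intro x hx
    nlinarith
  induction t with
  | halt => exact one_le_two
  | query q next ih => exact key _ (ih _)
  | guess k next ih =>
    refine key _ ?_
    split_ifs
    exacts [le_rfl, ih]

/-- Both scores in terms of the number `c` of queries and guesses. -/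
lemma exists_bonus_hit (a b : ℝ) (t : GuessTree Q R) (O : Q → ZMod 2) (r : R) :
    ∃ c, (t.bonus a O r = a ^ c ∧ t.hit b O r = 0) ∨
      (t.bonus a O r = 2 * a ^ c ∧ t.hit b O r = b ^ c) := by
  induction t with
  | halt => exact ⟨0, Or.inl ⟨by simp [bonus], rfl⟩⟩
  | query q next ih =>
    obtain ⟨c, h | h⟩ := ih (O q)
    · exact ⟨c + 1, Or.inl ⟨by rw [bonus, h.1, pow_succ'], by rw [hit, h.2, mul_zero]⟩⟩
    · exact ⟨c + 1, Or.inr ⟨by rw [bonus, h.1]; ring, by rw [hit, h.2, pow_succ']⟩⟩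
  | guess k next ih =>
    by_cases hk : k = r
    · exact ⟨1, Or.inr ⟨by simp [bonus, hk, mul_comm], by simp [hit, hk]⟩⟩
    obtain ⟨c, h | h⟩ := ih
    · exact ⟨c + 1, Or.inl ⟨by rw [bonus, if_neg hk, h.1, pow_succ'],
        by rw [hit, if_neg hk, h.2, mul_zero]⟩⟩
    · exact ⟨c + 1, Or.inr ⟨by rw [bonus, if_neg hk, h.1]; ring,
        by rw [hit, if_neg hk, h.2, pow_succ']⟩⟩

/-! ### The optimal total bonus and when stopping at once is optimal -/

section Value

variable (a : ℝ) (o : I → Q → ZMod 2) (ans : I → R)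

/-- The largest total `bonus` of a strategy on the set `B` of instances. -/
def value (B : Finset I) : ℝ :=
  ⨆ t : GuessTree Q R, ∑ i ∈ B, t.bonus a (o i) (ans i)

variable {a}

lemma bddAbove_bonus (ha : 0 ≤ a) (ha1 : a ≤ 1) (B : Finset I) :
    BddAbove (Set.range fun t : GuessTree Q R => ∑ i ∈ B, t.bonus a (o i) (ans i)) := by
  refine ⟨∑ i ∈ B, 2, ?_⟩
  rintro _ ⟨t, rfl⟩
  exact Finset.sum_le_sum fun i _ => bonus_le_two ha ha1 _ _ _

lemma sum_bonus_le_value (ha : 0 ≤ a) (ha1 : a ≤ 1) (B : Finset I) (t : GuessTree Q R) :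
    ∑ i ∈ B, t.bonus a (o i) (ans i) ≤ value a o ans B :=
  le_ciSup (bddAbove_bonus o ans ha ha1 B) t

lemma card_le_value (ha : 0 ≤ a) (ha1 : a ≤ 1) (B : Finset I) : (B.card : ℝ) ≤ value a o ans B :=
  le_trans (by simp [bonus]) (sum_bonus_le_value o ans ha ha1 B halt)

instance : Nonempty (GuessTree Q R) := ⟨halt⟩

/-- The strategies after the two answers can be chosen independently, so the two suprema are
attained together up to any error. -/
lemma value_query_le (ha : 0 ≤ a) (ha1 : a ≤ 1) (B : Finset I) (q : Q) :
    a * (value a o ans (B.filter fun i => o i q = 0) +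
      value a o ans (B.filter fun i => o i q = 1)) ≤ value a o ans B := by
  rw [value, value, mul_add, Real.mul_iSup_of_nonneg ha, Real.mul_iSup_of_nonneg ha]
  refine ciSup_add_ciSup_le fun t₀ t₁ => ?_
  refine le_trans (le_of_eq ?_)
    (sum_bonus_le_value o ans ha ha1 B (query q fun b => if b = 0 then t₀ else t₁))
  have h : (B.filter fun i => ¬ o i q = 0) = B.filter fun i => o i q = 1 :=
    Finset.filter_congr fun i _ =>
      ⟨(ZMod.two_cases _).resolve_left, fun h => by rw [h]; exact one_ne_zero⟩
  rw [← Finset.sum_filter_add_sum_filter_not B (fun i => o i q = 0), h, Finset.mul_sum,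
    Finset.mul_sum]
  congr 1 <;> refine Finset.sum_congr rfl fun i hi => ?_ <;>
    simp [bonus, (Finset.mem_filter.1 hi).2]

lemma value_guess_le (ha : 0 ≤ a) (ha1 : a ≤ 1) (B : Finset I) (k : R) :
    a * (2 * (B.filter fun i => k = ans i).card +
      value a o ans (B.filter fun i => ¬ k = ans i)) ≤ value a o ans B := by
  rw [value, mul_add, Real.mul_iSup_of_nonneg ha, ← le_sub_iff_add_le']
  refine ciSup_le fun t => ?_
  rw [le_sub_iff_add_le']
  refine le_trans (le_of_eq ?_) (sum_bonus_le_value o ans ha ha1 B (guess k t))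
  rw [← Finset.sum_filter_add_sum_filter_not B (fun i => k = ans i), Finset.mul_sum]
  congr 1
  · rw [Finset.sum_congr rfl (g := fun _ => a * 2)
      fun i hi => by simp [bonus, (Finset.mem_filter.1 hi).2]]
    rw [Finset.sum_const, nsmul_eq_mul]
    ring
  · refine Finset.sum_congr rfl fun i hi => ?_
    simp [bonus, (Finset.mem_filter.1 hi).2]

/-- If the game with discount `a ^ m` is hard, then no strategy beats the trivial one. -/
lemma value_univ_le [Fintype I] (ha : 0 < a) (ha1 : a < 1) {m : ℕ} (hm : 1 ≤ m)
    (hgap : 1 ≤ 2 ^ m * (1 - a) * (1 - a ^ m))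
    (hhit : ∀ t : GuessTree Q R, (1 - a ^ m) * 2 ^ (2 * m) * ∑ i, t.hit (a ^ m) (o i) (ans i) ≤
      a ^ m * Fintype.card I) :
    value a o ans Finset.univ ≤ Fintype.card I := by
  have ham : a ^ m < 1 := pow_lt_one₀ ha.le ha1 (by omega)
  have ham0 : 0 < a ^ m := by positivity
  refine ciSup_le fun t => ?_
  by_cases ht : t = halt
  · subst ht
    simp [bonus]
  -- A strategy other than `halt` makes at least one move. Its bonus is therefore at most $a$ unless
  -- it succeeds early, and the excess is charged to the score with discount $a^m$.
  have hpt : ∀ i, a ^ m * t.bonus a (o i) (ans i) ≤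
      a ^ m * a + 2 ^ m * t.hit (a ^ m) (o i) (ans i) := by
    intro i
    obtain ⟨c, hc⟩ : ∃ c, (t.bonus a (o i) (ans i) = a ^ (c + 1) ∧
          t.hit (a ^ m) (o i) (ans i) = 0) ∨
        (t.bonus a (o i) (ans i) = 2 * a ^ (c + 1) ∧
          t.hit (a ^ m) (o i) (ans i) = (a ^ m) ^ (c + 1)) := by
      cases t with
      | halt => exact absurd rfl ht
      | query q next =>
        obtain ⟨c, h | h⟩ := exists_bonus_hit a (a ^ m) (next (o i q)) (o i) (ans i)
        · exact ⟨c, Or.inl ⟨by rw [bonus, h.1, pow_succ'], by rw [hit, h.2, mul_zero]⟩⟩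
        · exact ⟨c, Or.inr ⟨by rw [bonus, h.1]; ring, by rw [hit, h.2, pow_succ']⟩⟩
      | guess k next =>
        by_cases hk : k = ans i
        · exact ⟨0, Or.inr ⟨by simp [bonus, hk, mul_comm], by simp [hit, hk]⟩⟩
        obtain ⟨c, h | h⟩ := exists_bonus_hit a (a ^ m) next (o i) (ans i)
        · exact ⟨c, Or.inl ⟨by rw [bonus, if_neg hk, h.1, pow_succ'],
            by rw [hit, if_neg hk, h.2, mul_zero]⟩⟩
        · exact ⟨c, Or.inr ⟨by rw [bonus, if_neg hk, h.1]; ring,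
            by rw [hit, if_neg hk, h.2, pow_succ']⟩⟩
    have hc1 : a ^ c ≤ 1 := pow_le_one₀ ha.le ha1.le
    rcases hc with h | h
    · rw [h.1, h.2, mul_zero, add_zero, pow_succ]
      exact mul_le_mul_of_nonneg_left (mul_le_of_le_one_left ha.le hc1) ham0.le
    · rw [h.1, h.2]
      -- A late success brings nothing: $2a^{c+1}\le a$. For an early one $2a^c>1$, so $(2a^c)^m\ge
      -- 1$ pays for an excess of at most $1$.
      by_cases hhalf : a ^ c ≤ 1 / 2
      · have h0 : 0 ≤ (2 : ℝ) ^ m * (a ^ m) ^ (c + 1) := by positivity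
        have h1 : 2 * a ^ (c + 1) ≤ a := by
          rw [pow_succ]
          nlinarith
        nlinarith
      · have h2 : 1 ≤ (2 * a ^ c) ^ m := one_le_pow₀ (by linarith)
        have h3 : (2 : ℝ) ^ m * (a ^ m) ^ (c + 1) = a ^ m * (2 * a ^ c) ^ m := by
          rw [mul_pow, ← pow_mul, ← pow_mul]
          ring
        have h4 : 2 * a ^ (c + 1) ≤ a + 1 := by
          rw [pow_succ]
          nlinarith
        rw [h3]
        nlinarith
  have hsum := Finset.sum_le_sum fun i (_ : i ∈ Finset.univ) => hpt i
  rw [← Finset.mul_sum, Finset.sum_add_distrib, Finset.sum_const, nsmul_eq_mul,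
    Finset.card_univ, ← Finset.mul_sum] at hsum
  set H := ∑ i, t.hit (a ^ m) (o i) (ans i) with hH
  have hH0 : 0 ≤ H := Finset.sum_nonneg fun i _ => hit_nonneg ham0.le _ _ _
  -- The total excess must fit into the loss $1-a$ per instance caused by the first move. `hgap`
  -- spends one of the two factors $2^m$ in `hhit` on this.
  have h1 : 2 ^ m * H ≤ (1 - a) * (a ^ m * Fintype.card I) := by
    have h2 := hhit t
    rw [← hH] at h2
    have h3 : 2 ^ m * H * 1 ≤ 2 ^ m * H * (2 ^ m * (1 - a) * (1 - a ^ m)) :=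
      mul_le_mul_of_nonneg_left hgap (by positivity)
    have h4 := mul_le_mul_of_nonneg_left h2 (sub_nonneg.2 ha1.le)
    have h5 : (2 : ℝ) ^ (2 * m) = 2 ^ m * 2 ^ m := by rw [two_mul, pow_add]
    rw [h5] at h4
    linarith
  have h2 : a ^ m * ∑ i, t.bonus a (o i) (ans i) ≤ a ^ m * Fintype.card I := by linarith
  exact le_of_mul_le_mul_left h2 ham0

end Value

/-- The discounted Kraft inequality for search games with arbitrary oracle and `a = 1 / 2`. -/
lemma sum_hit_half_le_one (o : R → Q → ZMod 2) (t : GuessTree Q R) (A : Finset R) :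
    ∑ s ∈ A, t.hit (1 / 2) (o s) s ≤ 1 := by
  induction t generalizing A with
  | halt => simp [hit]
  | query q next ih =>
    have h := fun b => ih b (A.filter fun s => o s q = b)
    have h1 : (A.filter fun i => ¬ o i q = 0) = A.filter fun i => o i q = 1 :=
      Finset.filter_congr fun i _ =>
        ⟨(ZMod.two_cases _).resolve_left, fun h => by rw [h]; exact one_ne_zero⟩
    rw [← Finset.sum_filter_add_sum_filter_not A (fun i => o i q = 0), h1]
    have h2 : ∀ b, ∑ s ∈ A.filter (fun s => o s q = b), (query q next).hit (1 / 2) (o s) s =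
        1 / 2 * ∑ s ∈ A.filter (fun s => o s q = b), (next b).hit (1 / 2) (o s) s := by
      intro b
      rw [Finset.mul_sum]
      exact Finset.sum_congr rfl fun i hi => by rw [hit, (Finset.mem_filter.1 hi).2]
    rw [h2, h2]
    linarith [h 0, h 1]
  | guess k next ih =>
    have h1 : ∀ s ∈ A, (guess k next).hit (1 / 2) (o s) s ≤
        1 / 2 * ((if k = s then 1 else 0) + next.hit (1 / 2) (o s) s) := by
      intro s _
      have := hit_nonneg (by norm_num : (0 : ℝ) ≤ 1 / 2) next (o s) s
      rw [hit]
      split_ifs <;> linarith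
    refine (Finset.sum_le_sum h1).trans ?_
    rw [← Finset.mul_sum, Finset.sum_add_distrib, Finset.sum_ite_eq]
    have := ih A
    split_ifs <;> linarith

end GuessTree

/-! ## The search game on the recursive oracle -/

instance ShiftTree.instFintype {V : Type} [Fintype V] [DecidableEq V] :
    (ℓ : ℕ) → Fintype (ShiftTree V ℓ)
  | 0 => inferInstanceAs (Fintype V)
  | ℓ + 1 =>
    haveI := ShiftTree.instFintype (V := V) ℓ
    inferInstanceAs (Fintype (V × (V → ShiftTree V ℓ)))

instance ShiftTree.instNonempty {V : Type} [Nonempty V] : (ℓ : ℕ) → Nonempty (ShiftTree V ℓ)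
  | 0 => inferInstanceAs (Nonempty V)
  | ℓ + 1 =>
    haveI := ShiftTree.instNonempty (V := V) ℓ
    inferInstanceAs (Nonempty (V × (V → ShiftTree V ℓ)))

/-- Conditioning on one smaller instance keeps a product set a product set, which makes the
induction over strategies possible. -/
lemma Fintype.piFinset_update_filter {V J : Type} [Fintype V] [DecidableEq V]
    (B : V → Finset J) (x : V) (p : J → Prop) [DecidablePred p] :
    Fintype.piFinset (Function.update B x ((B x).filter p)) =
      (Fintype.piFinset B).filter fun S => p (S x) := by
  ext S
  simp only [Fintype.mem_piFinset, Finset.mem_filter]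
  constructor
  · intro h
    have hx := h x
    rw [Function.update_self, Finset.mem_filter] at hx
    refine ⟨fun y => ?_, hx.2⟩
    by_cases hy : y = x
    · exact hy ▸ hx.1
    · simpa [hy] using h y
  · rintro ⟨h, hp⟩ y
    by_cases hy : y = x
    · subst hy
      simpa using ⟨h y, hp⟩
    · simpa [hy] using h y

namespace GuessTree

/-! ### Potentials of product sets of instances -/

section Step

variable {V : Type} [DecidableEq V]

/-- The potential of a set of instances of height `ℓ + 1` that is given by sets `B x` of smaller
instances, where those in `D` have been solved. -/
def potential {J Q : Type} (a : ℝ) (o : J → Q → ZMod 2) (ans : J → V) (D : Finset V)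
    (B : V → Finset J) (x : V) : ℝ :=
  if x ∈ D then (B x).card else value a o ans (B x)

variable {J Q : Type} {a : ℝ} {o : J → Q → ZMod 2} {ans : J → V}

lemma card_le_potential (ha : 0 ≤ a) (ha1 : a ≤ 1) (D : Finset V) (B : V → Finset J) (x : V) :
    ((B x).card : ℝ) ≤ potential a o ans D B x := by
  rw [potential]
  split_ifs
  exacts [le_rfl, card_le_value o ans ha ha1 _]

lemma potential_nonneg (ha : 0 ≤ a) (ha1 : a ≤ 1) (D : Finset V) (B : V → Finset J) (x : V) :
    0 ≤ potential a o ans D B x :=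
  (Nat.cast_nonneg _).trans (card_le_potential ha ha1 D B x)

lemma potential_query_le (ha : 0 ≤ a) (ha1 : a ≤ 1) (D : Finset V) (B : V → Finset J) (x : V)
    (q : Q) :
    a * (potential a o ans D (Function.update B x ((B x).filter fun i => o i q = 0)) x +
      potential a o ans D (Function.update B x ((B x).filter fun i => o i q = 1)) x) ≤
      potential a o ans D B x := by
  simp only [potential, Function.update_self]
  split_ifs
  · have h : ((B x).filter fun i => ¬ o i q = 0) = (B x).filter fun i => o i q = 1 :=
      Finset.filter_congr fun i _ =>
        ⟨(ZMod.two_cases _).resolve_left, fun h => by rw [h]; exact one_ne_zero⟩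
    rw [← h, ← Nat.cast_add, Finset.card_filter_add_card_filter_not]
    exact mul_le_of_le_one_left (Nat.cast_nonneg _) ha1
  · exact value_query_le o ans ha ha1 _ q

lemma prod_potential_update [Fintype V] (D : Finset V) (B : V → Finset J) (x : V) (B' : Finset J) :
    ∏ y, potential a o ans D (Function.update B x B') y =
      potential a o ans D (Function.update B x B') x *
        ∏ y ∈ Finset.univ.erase x, potential a o ans D B y := by
  rw [← Finset.mul_prod_erase _ _ (Finset.mem_univ x)]
  congr 1
  refine Finset.prod_congr rfl fun y hy => ?_
  simp [potential, Finset.ne_of_mem_erase hy]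

lemma prod_potential_insert [Fintype V] (D : Finset V) (B : V → Finset J) (x : V) (B' : Finset J) :
    ∏ y, potential a o ans (insert x D) (Function.update B x B') y =
      B'.card * ∏ y ∈ Finset.univ.erase x, potential a o ans D B y := by
  rw [← Finset.mul_prod_erase _ _ (Finset.mem_univ x)]
  congr 1
  · simp [potential]
  refine Finset.prod_congr rfl fun y hy => ?_
  simp [potential, Finset.ne_of_mem_erase hy]

end Step

variable {V : Type} [Fintype V] [DecidableEq V] [AddCommGroup V] {f fd : V → ZMod 2}

/-- The total score on a product set of instances of the recursive oracle is bounded by the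
product of the potentials. -/
lemma sum_hit_recOracle_le {ℓ : ℕ} {a : ℝ} (ha : 0 ≤ a) (ha1 : a < 1)
    (t : GuessTree (RecQuery V (ℓ + 1)) V) (A : Finset V) (B : V → Finset (ShiftTree V ℓ))
    (D : Finset V)
    (hD : ∀ x ∈ D, ∃ k v, (∀ S ∈ B x, ShiftTree.root ℓ S = k) ∧ ∀ s ∈ A, f (x + s) = v) :
    (1 - a) * ∑ s ∈ A, ∑ S ∈ Fintype.piFinset B,
        t.hit a (recOracle f fd (ℓ + 1) (s, S)) s ≤
      a * ∏ x, potential a (recOracle f fd ℓ) (ShiftTree.root ℓ) D B x := by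
  have ha' := sub_pos.2 ha1
  induction t generalizing A B D with
  | halt =>
    simp only [hit, Finset.sum_const_zero, mul_zero]
    exact mul_nonneg ha (Finset.prod_nonneg fun x _ => potential_nonneg ha ha1.le D B x)
  | guess k next ih =>
    -- A guess at the root is right for at most one $s$, so it gains at most the size of the product
    -- set, which is at most the product $P$ of the potentials. The factor $1-a$ closes the
    -- recursion: $a\bigl((1-a)P+aP\bigr)=aP$.
    have h1 : ∑ s ∈ A, ∑ S ∈ Fintype.piFinset B,
        (guess k next).hit a (recOracle f fd (ℓ + 1) (s, S)) s ≤
        a * (∏ x, potential a (recOracle f fd ℓ) (ShiftTree.root ℓ) D B x +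
          ∑ s ∈ A, ∑ S ∈ Fintype.piFinset B, next.hit a (recOracle f fd (ℓ + 1) (s, S)) s) := by
      calc _ ≤ ∑ s ∈ A, ∑ S ∈ Fintype.piFinset B, a * ((if k = s then 1 else 0) +
            next.hit a (recOracle f fd (ℓ + 1) (s, S)) s) := by
            refine Finset.sum_le_sum fun s _ => Finset.sum_le_sum fun S _ => ?_
            rw [hit]
            refine mul_le_mul_of_nonneg_left ?_ ha
            have := hit_nonneg ha next (recOracle f fd (ℓ + 1) (s, S)) s
            split_ifs <;> linarith
        _ = a * (∑ s ∈ A, (if k = s then 1 else 0) * ((Fintype.piFinset B).card : ℝ) +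
            ∑ s ∈ A, ∑ S ∈ Fintype.piFinset B, next.hit a (recOracle f fd (ℓ + 1) (s, S)) s) := by
            simp only [← Finset.mul_sum, Finset.sum_add_distrib, Finset.sum_const, nsmul_eq_mul,
              mul_comm]
        _ ≤ _ := by
            refine mul_le_mul_of_nonneg_left (add_le_add_left ?_ _) ha
            rw [← Finset.sum_mul, Finset.sum_ite_eq, Fintype.card_piFinset, Nat.cast_prod]
            refine le_trans (mul_le_of_le_one_left (by positivity) ?_)
              (Finset.prod_le_prod (fun _ _ => Nat.cast_nonneg _)
                fun x _ => card_le_potential ha ha1.le D B x)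
            split_ifs <;> norm_num
    have h2 := ih A B D hD
    set P := ∏ x, potential a (recOracle f fd ℓ) (ShiftTree.root ℓ) D B x
    have h3 := mul_le_mul_of_nonneg_left h1 ha'.le
    have h4 := mul_le_mul_of_nonneg_left h2 ha
    linarith
  | query q next ih =>
    have hpot : 0 ≤ ∏ x, potential a (recOracle f fd ℓ) (ShiftTree.root ℓ) D B x :=
      Finset.prod_nonneg fun x _ => potential_nonneg ha ha1.le D B x
    -- A query whose answer is constant on the current set only costs a factor $a$.
    have hconst : ∀ v, (∀ s ∈ A, ∀ S ∈ Fintype.piFinset B,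
        recOracle f fd (ℓ + 1) (s, S) q = v) →
        (1 - a) * ∑ s ∈ A, ∑ S ∈ Fintype.piFinset B,
          (query q next).hit a (recOracle f fd (ℓ + 1) (s, S)) s ≤
        a * ∏ x, potential a (recOracle f fd ℓ) (ShiftTree.root ℓ) D B x := by
      intro v hv
      have h1 : ∑ s ∈ A, ∑ S ∈ Fintype.piFinset B,
          (query q next).hit a (recOracle f fd (ℓ + 1) (s, S)) s =
          a * ∑ s ∈ A, ∑ S ∈ Fintype.piFinset B,
            (next v).hit a (recOracle f fd (ℓ + 1) (s, S)) s := by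
        simp only [Finset.mul_sum]
        exact Finset.sum_congr rfl fun s hs => Finset.sum_congr rfl fun S hS => by
          rw [hit, hv s hs S hS]
      rw [h1]
      have h2 := mul_le_mul_of_nonneg_left (ih v A B D hD) ha
      have h3 : a * (a * ∏ x, potential a (recOracle f fd ℓ) (ShiftTree.root ℓ) D B x) ≤
          a * ∏ x, potential a (recOracle f fd ℓ) (ShiftTree.root ℓ) D B x :=
        mul_le_of_le_one_left (mul_nonneg ha hpot) ha1.le
      linarith
    have hmem : ∀ {x : V} {p : ShiftTree V ℓ → Prop} [DecidablePred p] {y : V}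
        {S : ShiftTree V ℓ}, S ∈ Function.update B x ((B x).filter p) y → S ∈ B y := by
      intro x p _ y S hS
      by_cases hy : y = x
      · subst hy
        rw [Function.update_self] at hS
        exact (Finset.mem_filter.1 hS).1
      · rwa [Function.update_of_ne hy] at hS
    rcases q with ⟨q, key⟩ | ⟨x, q⟩
    · cases q with
      | base x => exact hconst (f x) fun _ _ _ _ => rfl
      | dual x => exact hconst (fd x) fun _ _ _ _ => rfl
      | shifted x =>
        by_cases hx : x ∈ D
        · obtain ⟨k, v, hk, hv⟩ := hD x hx
          refine hconst (if key = k then v else 0) fun s hs S hS => ?_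
          have h1 := hk _ (Fintype.mem_piFinset.1 hS x)
          simp only [recOracle, shiftOracle, h1, hv s hs]
        · have hans : ∀ s S, recOracle f fd (ℓ + 1) (s, S) (.inl (.shifted x, key)) =
              if key = ShiftTree.root ℓ (S x) then f (x + s) else 0 := fun _ _ => rfl
          set p : ShiftTree V ℓ → Prop := fun S => key = ShiftTree.root ℓ S with hp
          set Bk := Function.update B x ((B x).filter fun S => p S) with hBk
          set Bn := Function.update B x ((B x).filter fun S => ¬ p S) with hBn
          have hAsplit : (A.filter fun s => ¬ f (x + s) = 0) = A.filter fun s => f (x + s) = 1 :=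
            Finset.filter_congr fun i _ =>
              ⟨(ZMod.two_cases _).resolve_left, fun h => by rw [h]; exact one_ne_zero⟩
          -- A right key with bit $0$ and a wrong key both lead to `next 0`, but they are bounded
          -- separately, as if the key had been confirmed. Only the right key puts $x$ into `D`.
          have hsplit : ∑ s ∈ A, ∑ S ∈ Fintype.piFinset B,
              (query (.inl (.shifted x, key)) next).hit a (recOracle f fd (ℓ + 1) (s, S)) s =
              a * (∑ s ∈ A.filter (fun s => f (x + s) = 0), ∑ S ∈ Fintype.piFinset Bk,
                  (next 0).hit a (recOracle f fd (ℓ + 1) (s, S)) s +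
                ∑ s ∈ A.filter (fun s => f (x + s) = 1), ∑ S ∈ Fintype.piFinset Bk,
                  (next 1).hit a (recOracle f fd (ℓ + 1) (s, S)) s +
                ∑ s ∈ A, ∑ S ∈ Fintype.piFinset Bn,
                  (next 0).hit a (recOracle f fd (ℓ + 1) (s, S)) s) := by
            have h0 : ∀ s, ∑ S ∈ Fintype.piFinset B,
                (query (.inl (.shifted x, key)) next).hit a (recOracle f fd (ℓ + 1) (s, S)) s =
                a * ∑ S ∈ Fintype.piFinset Bk,
                  (next (f (x + s))).hit a (recOracle f fd (ℓ + 1) (s, S)) s +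
                a * ∑ S ∈ Fintype.piFinset Bn,
                  (next 0).hit a (recOracle f fd (ℓ + 1) (s, S)) s := by
              intro s
              rw [hBk, hBn, Fintype.piFinset_update_filter, Fintype.piFinset_update_filter,
                ← Finset.sum_filter_add_sum_filter_not _ (fun S => p (S x)), Finset.mul_sum,
                Finset.mul_sum]
              congr 1 <;> refine Finset.sum_congr rfl fun S hS => ?_
              · exact hit_query ((hans s S).trans (if_pos (Finset.mem_filter.1 hS).2))
              · exact hit_query ((hans s S).trans (if_neg (Finset.mem_filter.1 hS).2))
            simp only [h0]
            rw [Finset.sum_add_distrib, ← Finset.mul_sum, ← Finset.mul_sum, ← mul_add,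
              ← Finset.sum_filter_add_sum_filter_not A (fun s => f (x + s) = 0), hAsplit]
            congr 3 <;> refine Finset.sum_congr rfl fun s hs => ?_ <;>
              rw [(Finset.mem_filter.1 hs).2]
          have hDk : ∀ v, ∀ y ∈ insert x D, ∃ k u,
              (∀ S ∈ Bk y, ShiftTree.root ℓ S = k) ∧
                ∀ s ∈ A.filter (fun s => f (x + s) = v), f (y + s) = u := by
            intro v y hy
            by_cases hyx : y = x
            · subst hyx
              refine ⟨key, v, fun S hS => ?_, fun s hs => (Finset.mem_filter.1 hs).2⟩
              rw [hBk, Function.update_self] at hS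
              exact (Finset.mem_filter.1 hS).2.symm
            · obtain ⟨k, u, hk, hu⟩ := hD y ((Finset.mem_insert.1 hy).resolve_left hyx)
              exact ⟨k, u, fun S hS => hk S (hmem hS),
                fun s hs => hu s (Finset.mem_filter.1 hs).1⟩
          have hDn : ∀ y ∈ D, ∃ k u,
              (∀ S ∈ Bn y, ShiftTree.root ℓ S = k) ∧ ∀ s ∈ A, f (y + s) = u := by
            intro y hy
            obtain ⟨k, u, hk, hu⟩ := hD y hy
            exact ⟨k, u, fun S hS => hk S (hmem hS), hu⟩
          have i0 := ih 0 _ Bk (insert x D) (hDk 0)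
          have i1 := ih 1 _ Bk (insert x D) (hDk 1)
          have i2 := ih 0 A Bn D hDn
          rw [hBk, prod_potential_insert, ← hBk] at i0 i1
          rw [hBn, prod_potential_update, ← hBn] at i2
          have hBnx : potential a (recOracle f fd ℓ) (ShiftTree.root ℓ) D Bn x =
              value a (recOracle f fd ℓ) (ShiftTree.root ℓ) ((B x).filter fun S => ¬ p S) := by
            rw [potential, if_neg hx, hBn, Function.update_self]
          rw [hBnx] at i2
          rw [hsplit, ← Finset.mul_prod_erase _ _ (Finset.mem_univ x), potential, if_neg hx]
          -- The two outcomes of a right key each contribute the number of instances with that key,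
          -- since the bounds do not depend on `A`. This is the reward $2$ of the game, and testing
          -- a key is a guess in it.
          have hv := value_guess_le (recOracle f fd ℓ) (ShiftTree.root ℓ) ha ha1.le (B x) key
          have hE : 0 ≤ ∏ y ∈ Finset.univ.erase x,
              potential a (recOracle f fd ℓ) (ShiftTree.root ℓ) D B y :=
            Finset.prod_nonneg fun y _ => potential_nonneg ha ha1.le D B y
          set E := ∏ y ∈ Finset.univ.erase x,
              potential a (recOracle f fd ℓ) (ShiftTree.root ℓ) D B y
          have h5 := mul_le_mul_of_nonneg_left (mul_le_mul_of_nonneg_right hv hE) ha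
          have h6 := mul_le_mul_of_nonneg_left (add_le_add (add_le_add i0 i1) i2) ha
          refine le_trans (le_of_eq ?_) (h6.trans (le_trans (le_of_eq ?_) h5))
          · ring
          · simp only [hp]
            ring
    · have hans : ∀ s S, recOracle f fd (ℓ + 1) (s, S) (.inr (x, q)) =
          recOracle f fd ℓ (S x) q := fun _ _ => rfl
      have hnot : ((Fintype.piFinset B).filter fun S => ¬ recOracle f fd ℓ (S x) q = 0) =
          (Fintype.piFinset B).filter fun S => recOracle f fd ℓ (S x) q = 1 :=
        Finset.filter_congr fun i _ =>
          ⟨(ZMod.two_cases _).resolve_left, fun h => by rw [h]; exact one_ne_zero⟩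
      set Bv : ZMod 2 → V → Finset (ShiftTree V ℓ) := fun v =>
        Function.update B x ((B x).filter fun S => recOracle f fd ℓ S q = v) with hBv
      have hsplit : ∑ s ∈ A, ∑ S ∈ Fintype.piFinset B,
          (query (.inr (x, q)) next).hit a (recOracle f fd (ℓ + 1) (s, S)) s =
          a * (∑ s ∈ A, ∑ S ∈ Fintype.piFinset (Bv 0),
              (next 0).hit a (recOracle f fd (ℓ + 1) (s, S)) s +
            ∑ s ∈ A, ∑ S ∈ Fintype.piFinset (Bv 1),
              (next 1).hit a (recOracle f fd (ℓ + 1) (s, S)) s) := by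
        rw [← Finset.sum_add_distrib, Finset.mul_sum]
        refine Finset.sum_congr rfl fun s _ => ?_
        simp only [hBv, Fintype.piFinset_update_filter]
        rw [← Finset.sum_filter_add_sum_filter_not _ (fun S => recOracle f fd ℓ (S x) q = 0),
          hnot, mul_add, Finset.mul_sum, Finset.mul_sum]
        congr 1 <;> refine Finset.sum_congr rfl fun S hS => ?_ <;>
          exact hit_query ((hans s S).trans (Finset.mem_filter.1 hS).2)
      have hDv : ∀ v, ∀ y ∈ D, ∃ k u,
          (∀ S ∈ Bv v y, ShiftTree.root ℓ S = k) ∧ ∀ s ∈ A, f (y + s) = u := by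
        intro v y hy
        obtain ⟨k, u, hk, hu⟩ := hD y hy
        exact ⟨k, u, fun S hS => hk S (hmem hS), hu⟩
      have i0 := ih 0 A (Bv 0) D (hDv 0)
      have i1 := ih 1 A (Bv 1) D (hDv 1)
      simp only [hBv, prod_potential_update] at i0 i1
      rw [hsplit, ← Finset.mul_prod_erase _ _ (Finset.mem_univ x)]
      have hv := potential_query_le (o := recOracle f fd ℓ) (ans := ShiftTree.root ℓ) ha ha1.le
        D B x q
      have hE : 0 ≤ ∏ y ∈ Finset.univ.erase x,
          potential a (recOracle f fd ℓ) (ShiftTree.root ℓ) D B y :=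
        Finset.prod_nonneg fun y _ => potential_nonneg ha ha1.le D B y
      have h5 := mul_le_mul_of_nonneg_left (mul_le_mul_of_nonneg_right hv hE) ha
      have h6 := mul_le_mul_of_nonneg_left (add_le_add i0 i1) ha
      refine le_trans (le_of_eq ?_) (h6.trans (le_trans (le_of_eq ?_) h5)) <;> ring

/-- The search game for the root of the recursive oracle of height `ℓ` is hard. -/
lemma sum_hit_le {m : ℕ} (hm : 1 ≤ m) (hV : Fintype.card V = 2 ^ (2 * m)) (ℓ : ℕ) {a : ℝ}
    (ha : 0 < a) (ha2 : a ^ m ^ ℓ = 1 / 2)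
    (hgap : ∀ j < ℓ, ∀ b : ℝ, 0 < b → b ^ m ^ (j + 1) = 1 / 2 →
      1 ≤ 2 ^ m * (1 - b) * (1 - b ^ m))
    (t : GuessTree (RecQuery V ℓ) V) :
    (1 - a) * 2 ^ (2 * m) * ∑ S, t.hit a (recOracle f fd ℓ S) (ShiftTree.root ℓ S) ≤
      a * Fintype.card (ShiftTree V ℓ) := by
  have ha1 : a < 1 := by
    by_contra! h
    have := one_le_pow₀ (n := m ^ ℓ) h
    norm_num [ha2] at this
  induction ℓ generalizing a with
  | zero =>
    rw [pow_zero, pow_one] at ha2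
    subst ha2
    have h := sum_hit_half_le_one (R := V) (fun s => recOracle f fd 0 s) t Finset.univ
    have hc : (Fintype.card (ShiftTree V 0) : ℝ) = 2 ^ (2 * m) := by exact_mod_cast hV
    rw [hc]
    have h2 : (0 : ℝ) ≤ 2 ^ (2 * m) := by positivity
    have h3 := mul_le_mul_of_nonneg_left h h2
    have h4 : ∑ S, t.hit (1 / 2) (recOracle f fd 0 S) (ShiftTree.root 0 S) =
      ∑ s : V, t.hit (1 / 2) (recOracle f fd 0 s) s := rfl
    rw [h4]
    linarith
  | succ ℓ ih =>
    -- The discount $a^m$ is the one that belongs to height $\ell$.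
    have ham : (a ^ m) ^ m ^ ℓ = 1 / 2 := by rw [← pow_mul, ← pow_succ', ha2]
    have hval := value_univ_le (recOracle f fd ℓ) (ShiftTree.root ℓ) ha ha1 hm
      (hgap ℓ ℓ.lt_succ_self a ha ha2)
      fun t => ih (pow_pos ha m) ham (fun j hj => hgap j (hj.trans ℓ.lt_succ_self)) t
        (pow_lt_one₀ ha.le ha1 (by omega))
    have h := sum_hit_recOracle_le (f := f) (fd := fd) ha.le ha1 t Finset.univ
      (fun _ => Finset.univ) ∅ (by simp)
    -- With nothing solved, each potential is a value on all instances, hence at most their number.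
    have hprod : ∏ x : V, potential a (recOracle f fd ℓ) (ShiftTree.root ℓ) ∅
        (fun _ => Finset.univ) x ≤ (Fintype.card (ShiftTree V ℓ) : ℝ) ^ Fintype.card V := by
      rw [← Finset.card_univ (α := V), ← Finset.prod_const]
      refine Finset.prod_le_prod (fun x _ => potential_nonneg ha.le ha1.le _ _ x) fun x _ => ?_
      simpa [potential] using hval
    have hcard : (Fintype.card (ShiftTree V (ℓ + 1)) : ℝ) =
        2 ^ (2 * m) * (Fintype.card (ShiftTree V ℓ) : ℝ) ^ Fintype.card V := by
      have : Fintype.card (ShiftTree V (ℓ + 1)) =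
          Fintype.card (V × (V → ShiftTree V ℓ)) := rfl
      rw [this, Fintype.card_prod, Fintype.card_fun]
      push_cast
      rw [hV]
      push_cast
      ring
    have hsum : ∑ S, t.hit a (recOracle f fd (ℓ + 1) S) (ShiftTree.root (ℓ + 1) S) =
        ∑ s : V, ∑ S : V → ShiftTree V ℓ, t.hit a (recOracle f fd (ℓ + 1) (s, S)) s :=
      Fintype.sum_prod_type _
    rw [Fintype.piFinset_univ, ← hsum] at h
    rw [hcard]
    have h2 : (0 : ℝ) ≤ 2 ^ (2 * m) := by positivity
    have h3 := mul_le_mul_of_nonneg_left (h.trans (mul_le_mul_of_nonneg_left hprod ha.le)) h2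
    linarith

end GuessTree

/-! ## Lower bounds for randomized algorithms -/

namespace DecisionTree

variable {Q R : Type}

/-- The strategy that runs the decision tree and guesses its output. -/
def toGuess : DecisionTree Q R → GuessTree Q R
  | output r => .guess r .halt
  | query q next => .query q fun b => (next b).toGuess

lemma hit_toGuess [DecidableEq R] (a : ℝ) (t : DecisionTree Q R) (O : Q → ZMod 2) (r : R) :
    t.toGuess.hit a O r = if t.eval O = r then a ^ (t.cost O + 1) else 0 := by
  induction t with
  | output k => simp [toGuess, GuessTree.hit, eval, cost]
  | query q next ih =>
    rw [toGuess, GuessTree.hit, ih, eval, cost, mul_ite, mul_zero, ← pow_succ']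

end DecisionTree

/-! ### From randomized algorithms to a single decision tree -/

section Averaging

variable {I Q R : Type} [Fintype I] [DecidableEq R] {μ : PMF (DecisionTree Q R)}
  {oracle : I → Q → ZMod 2} {answer : I → R} {T : ℕ}

/-- Some decision tree in the support of a randomized algorithm is right on two thirds of the
instances. -/
lemma RandomizedSolves.exists_tree (h : RandomizedSolves μ oracle answer T) :
    ∃ t ∈ μ.support, 2 * Fintype.card I ≤
      3 * (Finset.univ.filter fun i => t.eval (oracle i) = answer i).card := by
  set c : DecisionTree Q R → ℕ := fun t =>
    (Finset.univ.filter fun i => t.eval (oracle i) = answer i).card with hc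
  -- The support may be infinite, but the counts are bounded integers, so the maximum exists.
  obtain ⟨t₀, ht₀, hmax⟩ : ∃ t₀ ∈ μ.support, ∀ t ∈ μ.support, c t ≤ c t₀ := by
    have hb : BddAbove (c '' μ.support) := by
      refine ⟨Fintype.card I, ?_⟩
      rintro _ ⟨t, -, rfl⟩
      exact Finset.card_le_univ _
    obtain ⟨t₀, ht₀, h₀⟩ := Nat.sSup_mem (μ.support_nonempty.image c) hb
    exact ⟨t₀, ht₀, fun t ht => h₀ ▸ le_csSup hb ⟨t, ht, rfl⟩⟩
  refine ⟨t₀, ht₀, ?_⟩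
  have h1 : ∑ _i : I, (2 / 3 : ENNReal) ≤ c t₀ := by
    calc ∑ _i : I, (2 / 3 : ENNReal)
        ≤ ∑ i, (μ.map fun t => t.eval (oracle i)) (answer i) :=
          Finset.sum_le_sum fun i _ => h.2 i
      _ = ∑ i, ∑' t, if answer i = t.eval (oracle i) then μ t else 0 := by
          refine Finset.sum_congr rfl fun i _ => ?_
          rw [PMF.map_apply]
          exact tsum_congr fun t => by congr
      _ = ∑' t, ∑ i, if answer i = t.eval (oracle i) then μ t else 0 :=
          (Summable.tsum_finsetSum fun i _ => ENNReal.summable).symm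
      _ ≤ ∑' t, μ t * c t₀ := by
          refine ENNReal.tsum_le_tsum fun t => ?_
          by_cases ht : t ∈ μ.support
          · simp only [eq_comm (a := answer _)]
            rw [← Finset.sum_filter, Finset.sum_const, nsmul_eq_mul, mul_comm]
            gcongr
            exact hmax t ht
          · simp [(PMF.apply_eq_zero_iff μ t).2 ht]
      _ = c t₀ := by rw [ENNReal.tsum_mul_right, PMF.tsum_coe, one_mul]
  rw [Finset.sum_const, nsmul_eq_mul, Finset.card_univ] at h1
  have h2 := ENNReal.toReal_mono (ENNReal.natCast_ne_top _) h1
  simp only [ENNReal.toReal_mul, ENNReal.toReal_natCast, ENNReal.toReal_div,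
    ENNReal.toReal_ofNat] at h2
  have h3 : 2 * (Fintype.card I : ℝ) ≤ 3 * c t₀ := by linarith
  exact_mod_cast h3

omit [Fintype I] in
-- On two instances, being right on two thirds means being right on both, which a tree without
-- queries cannot be if the answers differ.
lemma RandomizedSolves.one_le (h : RandomizedSolves μ oracle answer T) {i j : I}
    (hij : answer i ≠ answer j) : 1 ≤ T := by
  by_contra! hT
  have h' : RandomizedSolves μ (fun b : Bool => oracle (if b then i else j))
      (fun b => answer (if b then i else j)) T :=
    ⟨fun t ht b => h.1 t ht _, fun b => h.2 _⟩
  obtain ⟨t, ht, hcard⟩ := h'.exists_tree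
  have hall : ∀ b : Bool, t.eval (oracle (if b then i else j)) =
      answer (if b then i else j) := by
    by_contra! hne
    obtain ⟨b, hne⟩ := hne
    have := Finset.card_lt_univ_of_notMem (s := Finset.univ.filter fun b : Bool =>
      t.eval (oracle (if b then i else j)) = answer (if b then i else j)) (x := b)
      (by simpa using hne)
    rw [Fintype.card_bool] at *
    omega
  cases t with
  | output r => exact hij ((hall true).symm.trans (hall false))
  | query q next =>
    have := h.1 _ ht i
    rw [DecisionTree.cost] at this
    omega

end Averaging

/-- By Bernoulli's inequality $(1-1/(2D))^D\ge 1/2$. -/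
lemma one_div_le_one_sub_of_pow_eq_half {b : ℝ} {D : ℕ} (hD : b ^ D = 1 / 2) :
    1 / (2 * D : ℝ) ≤ 1 - b := by
  have hD0 : D ≠ 0 := by
    rintro rfl
    norm_num at hD
  have hD1 : (1 : ℝ) ≤ D := by exact_mod_cast Nat.one_le_iff_ne_zero.2 hD0
  by_contra! hlt
  have hle : 1 / (2 * D : ℝ) ≤ 1 / 2 := one_div_le_one_div_of_le (by norm_num) (by linarith)
  have h1 : (1 + -(1 / (2 * D : ℝ))) ^ D < b ^ D :=
    pow_lt_pow_left₀ (by linarith) (by linarith) hD0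
  have h2 := one_add_mul_le_pow (a := -(1 / (2 * D : ℝ))) (by linarith) D
  have h3 : (D : ℝ) * -(1 / (2 * D : ℝ)) = -(1 / 2) := by
    field_simp
  linarith

lemma exists_pow_eq_half {D : ℕ} (hD : D ≠ 0) : ∃ a : ℝ, 0 < a ∧ a ^ D = 1 / 2 :=
  ⟨(1 / 2) ^ (1 / D : ℝ), by positivity, by
    rw [one_div (D : ℝ), Real.rpow_inv_natCast_pow (by norm_num) hD]⟩

/-! ### Query lower bounds for both oracles -/

section RecursiveLowerBound

variable {V : Type} [Fintype V] [DecidableEq V] [AddCommGroup V] {f fd : V → ZMod 2}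

lemma RandomizedSolves.pow_le {m : ℕ} (hm : 1 ≤ m) (hV : Fintype.card V = 2 ^ (2 * m)) {ℓ : ℕ}
    {a : ℝ} (ha : 0 < a) (ha2 : a ^ m ^ ℓ = 1 / 2)
    (hgap : ∀ j < ℓ, ∀ b : ℝ, 0 < b → b ^ m ^ (j + 1) = 1 / 2 →
      1 ≤ 2 ^ m * (1 - b) * (1 - b ^ m))
    {μ : PMF (DecisionTree (RecQuery V ℓ) V)} {T : ℕ}
    (h : RandomizedSolves μ (recOracle f fd ℓ) (ShiftTree.root ℓ) T) :
    2 * (1 - a) * 2 ^ (2 * m) * a ^ T ≤ 3 := by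
  have ha1 : a < 1 := by
    by_contra! h
    have := one_le_pow₀ (n := m ^ ℓ) h
    norm_num [ha2] at this
  obtain ⟨t, ht, hcard⟩ := h.exists_tree
  have hsum := GuessTree.sum_hit_le (f := f) (fd := fd) hm hV ℓ ha ha2 hgap t.toGuess
  set M := (Finset.univ.filter fun S => t.eval (recOracle f fd ℓ S) = ShiftTree.root ℓ S).card
  have h1 : M * a ^ (T + 1) ≤
      ∑ S, t.toGuess.hit a (recOracle f fd ℓ S) (ShiftTree.root ℓ S) := by
    simp only [DecisionTree.hit_toGuess]
    rw [← Finset.sum_filter, ← nsmul_eq_mul, ← Finset.sum_const]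
    -- The final guess of the output is one move more than the queries, hence the exponent $T+1$.
    exact Finset.sum_le_sum fun S _ => pow_le_pow_of_le_one ha.le ha1.le
      (Nat.succ_le_succ (h.1 t ht S))
  have hI : (0 : ℝ) < Fintype.card (ShiftTree V ℓ) := by exact_mod_cast Fintype.card_pos
  set N := Fintype.card (ShiftTree V ℓ)
  have hcard' : 2 * (N : ℝ) ≤ 3 * M := by exact_mod_cast hcard
  have hX : 0 ≤ (1 - a) * 2 ^ (2 * m) := mul_nonneg (sub_nonneg.2 ha1.le) (by positivity)
  have h2 := (mul_le_mul_of_nonneg_left h1 hX).trans hsum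
  have h3 := mul_le_mul_of_nonneg_left hcard' (mul_nonneg hX (pow_pos ha (T + 1)).le)
  have h4 : (a * N) * (2 * (1 - a) * 2 ^ (2 * m) * a ^ T) ≤ (a * N) * 3 := by
    rw [pow_succ] at h2 h3
    linarith
  exact le_of_mul_le_mul_left h4 (mul_pos ha hI)

lemma RandomizedSolves.le_of_shiftOracle {m : ℕ} (hm : 1 ≤ m)
    (hV : Fintype.card V = 2 ^ (2 * m)) {μ : PMF (DecisionTree (ShiftQuery V) V)} {T : ℕ}
    (h : RandomizedSolves μ (fun s => shiftOracle f fd s) (fun s => s) T) : m ≤ T := by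
  have h' : RandomizedSolves (I := ShiftTree V 0) (Q := RecQuery V 0) μ (recOracle f fd 0)
    (ShiftTree.root 0) T := h
  have h1 := h'.pow_le (a := 1 / 2) hm hV (by norm_num) (by norm_num) (by simp)
  by_contra! hT
  have h2 : ((1 : ℝ) / 2) ^ m ≤ (1 / 2) ^ (T + 1) :=
    pow_le_pow_of_le_one (by norm_num) (by norm_num) hT
  have h3 : (2 : ℝ) ^ (2 * m) * (1 / 2) ^ m = 2 ^ m := by
    rw [two_mul, pow_add, mul_assoc, ← mul_pow]
    norm_num
  have h4 : (2 : ℝ) ^ 1 ≤ 2 ^ m := pow_le_pow_right₀ (by norm_num) hm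
  have h5 := mul_le_mul_of_nonneg_left h2 (by positivity : (0 : ℝ) ≤ 2 ^ (2 * m))
  rw [pow_succ] at h5
  linarith

/-- The inequality fails for $k=6$, which is where the threshold $128=2^7$ for $m$ comes from. -/
lemma quadratic_le_two_pow {k : ℕ} (hk : 7 ≤ k) : (k + 1) * (2 * k + 1) + 2 ≤ 2 ^ k := by
  induction k, hk using Nat.le_induction with
  | base => norm_num
  | succ k hk ih =>
    rw [pow_succ]
    nlinarith

/-- The polynomial factors are negligible against `2 ^ m`. -/
lemma four_mul_pow_le {m : ℕ} (hm : 128 ≤ m) {j : ℕ} (hj : j ≤ Nat.log 2 m) :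
    4 * m ^ (2 * j + 1) ≤ 2 ^ m := by
  set k := Nat.log 2 m with hk
  have hk7 : 7 ≤ k := Nat.le_log_of_pow_le (by norm_num) (by omega)
  have hmk : m ≤ 2 ^ (k + 1) := (Nat.lt_pow_succ_log_self (by norm_num) m).le
  calc 4 * m ^ (2 * j + 1) ≤ 4 * m ^ (2 * k + 1) :=
        Nat.mul_le_mul_left _ (Nat.pow_le_pow_right (by omega) (by omega))
    _ ≤ 4 * (2 ^ (k + 1)) ^ (2 * k + 1) :=
        Nat.mul_le_mul_left _ (Nat.pow_le_pow_left hmk _)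
    _ = 2 ^ ((k + 1) * (2 * k + 1) + 2) := by
        rw [← pow_mul, pow_add]
        ring
    _ ≤ 2 ^ m := Nat.pow_le_pow_right (by norm_num)
        ((quadratic_le_two_pow hk7).trans (Nat.pow_log_le_self 2 (by omega)))

lemma RandomizedSolves.pow_log_le {m : ℕ} (hm : 128 ≤ m) (hV : Fintype.card V = 2 ^ (2 * m))
    {μ : PMF (DecisionTree (RecQuery V (Nat.log 2 (2 * m))) V)} {T : ℕ}
    (h : RandomizedSolves μ (recOracle f fd _) (ShiftTree.root _) T) :
    m ^ (Nat.log 2 (2 * m) + 1) ≤ T := by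
  have hlog : Nat.log 2 (2 * m) = Nat.log 2 m + 1 := by
    rw [mul_comm, Nat.log_mul_base (by norm_num) (by omega)]
  -- The two gaps are at least $1/(2m^{j+1})$ and $1/(2m^j)$, so the condition becomes $4m^{2j+1}\le
  -- 2^m$.
  have hgap : ∀ j < Nat.log 2 (2 * m), ∀ b : ℝ, 0 < b → b ^ m ^ (j + 1) = 1 / 2 →
      1 ≤ 2 ^ m * (1 - b) * (1 - b ^ m) := by
    intro j hj b _ hb2
    have h1 := one_div_le_one_sub_of_pow_eq_half hb2
    have h2 := one_div_le_one_sub_of_pow_eq_half (b := b ^ m) (D := m ^ j)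
      (by rw [← pow_mul, ← pow_succ', hb2])
    have h3 : (4 : ℝ) * m ^ (2 * j + 1) ≤ 2 ^ m := by
      exact_mod_cast four_mul_pow_le hm (j := j) (by omega)
    have hm0 : (0 : ℝ) < m := by exact_mod_cast (by omega : 0 < m)
    push_cast at h1 h2
    calc (1 : ℝ) = 4 * m ^ (2 * j + 1) * (1 / (2 * m ^ (j + 1))) * (1 / (2 * m ^ j)) := by
          field_simp
          ring
      _ ≤ 2 ^ m * (1 - b) * (1 - b ^ m) := by
          have : (0 : ℝ) ≤ 1 / (2 * m ^ (j + 1)) := by positivity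
          have : (0 : ℝ) ≤ 1 / (2 * m ^ j) := by positivity
          gcongr
          exact mul_nonneg (by positivity) (by linarith)
  set ℓ := Nat.log 2 (2 * m)
  obtain ⟨a, ha, ha2⟩ := exists_pow_eq_half (D := m ^ ℓ) (pow_ne_zero _ (by omega))
  have ha1 : a < 1 := by
    by_contra! h
    have := one_le_pow₀ (n := m ^ ℓ) h
    norm_num [ha2] at this
  have h1 := h.pow_le (by omega) hV ha ha2 hgap
  have h2 := one_div_le_one_sub_of_pow_eq_half ha2
  push_cast at h2
  have hm0 : (0 : ℝ) < m := by exact_mod_cast (by omega : 0 < m)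
  have h3 : (3 : ℝ) * m ^ ℓ ≤ 2 ^ m := by
    have := four_mul_pow_le hm le_rfl
    have h4 : m ^ ℓ ≤ m ^ (2 * Nat.log 2 m + 1) := Nat.pow_le_pow_right (by omega) (by omega)
    exact_mod_cast (by omega : 3 * m ^ ℓ ≤ 2 ^ m)
  -- Half of the exponent in $2^{2m}$ is given up for the factor $3m^\ell$; the other half gives
  -- $a^T\le 2^{-m}=a^{m^\ell m}$.
  have h4 : (2 : ℝ) ^ m * a ^ T ≤ 1 := by
    have hD : (0 : ℝ) < m ^ ℓ := by positivity
    have h5 : 1 / (2 * (m : ℝ) ^ ℓ) * (2 * 2 ^ (2 * m) * a ^ T) ≤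
        (1 - a) * (2 * 2 ^ (2 * m) * a ^ T) :=
      mul_le_mul_of_nonneg_right h2 (by positivity)
    have h6 : 1 / (2 * (m : ℝ) ^ ℓ) * (2 * 2 ^ (2 * m) * a ^ T) =
        2 ^ (2 * m) * a ^ T / m ^ ℓ := by
      field_simp
    have h7 : (2 : ℝ) ^ (2 * m) * a ^ T / m ^ ℓ ≤ 3 := by linarith
    rw [div_le_iff₀ hD] at h7
    have h8 : (2 : ℝ) ^ m * (2 ^ m * a ^ T) ≤ 2 ^ m * 1 := by
      rw [two_mul, pow_add] at h7
      linarith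
    exact le_of_mul_le_mul_left h8 (by positivity)
  have h5 : a ^ T ≤ a ^ (m ^ ℓ * m) := by
    rw [pow_mul, ha2, one_div, inv_pow, ← one_div, le_div_iff₀ (by positivity)]
    linarith
  rw [pow_succ]
  exact (pow_le_pow_iff_right_of_lt_one₀ ha ha1).1 h5

end RecursiveLowerBound

/-! ## The exponents -/

section Exponents

variable {m : ℕ}

lemma logb_le_log_add_one (hm : 1 ≤ m) :
    Real.logb 2 ((2 * m : ℕ) : ℝ) ≤ (Nat.log 2 (2 * m) : ℝ) + 1 := by
  rw [Real.logb_le_iff_le_rpow (by norm_num) (by exact_mod_cast (by omega : 0 < 2 * m))]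
  exact_mod_cast (Nat.lt_pow_succ_log_self (by norm_num) (2 * m)).le

lemma log_le_logb (hm : 1 ≤ m) :
    (Nat.log 2 (2 * m) : ℝ) ≤ Real.logb 2 ((2 * m : ℕ) : ℝ) := by
  rw [Real.le_logb_iff_rpow_le (by norm_num) (by exact_mod_cast (by omega : 0 < 2 * m))]
  exact_mod_cast Nat.pow_log_le_self 2 (by omega)

/-- Replacing $m$ by $n=2m$ costs $2^{\ell+1}\le n^2$, and rounding the logarithm costs one more in
the exponent. For $m<128$ one has $\log_2 n\le 8$, so the exponent is negative and one query
suffices for the bound. -/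
lemma rpow_logb_sub_le (hm : 1 ≤ m) {T : ℕ} (hT : 1 ≤ T)
    (h : 128 ≤ m → m ^ (Nat.log 2 (2 * m) + 1) ≤ T) :
    ((2 * m : ℕ) : ℝ) ^ (Real.logb 2 ((2 * m : ℕ) : ℝ) - 9) ≤ T := by
  have hn1 : (1 : ℝ) ≤ ((2 * m : ℕ) : ℝ) := by exact_mod_cast (by omega : 1 ≤ 2 * m)
  by_cases h128 : 128 ≤ m
  · set ℓ := Nat.log 2 (2 * m) with hℓ
    have h1 : (2 * m) ^ (ℓ + 1) ≤ m ^ (ℓ + 1) * (2 * m) ^ 2 := by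
      have h2 : 2 ^ ℓ ≤ 2 * m := Nat.pow_log_le_self 2 (by omega)
      calc (2 * m) ^ (ℓ + 1) = m ^ (ℓ + 1) * (2 ^ ℓ * 2) := by rw [mul_pow]; ring
        _ ≤ m ^ (ℓ + 1) * (2 * m) ^ 2 := by
            rw [sq]
            exact Nat.mul_le_mul_left _ (Nat.mul_le_mul h2 (by omega))
    have h3 : ((2 * m : ℕ) : ℝ) ^ (ℓ + 1) ≤ T * ((2 * m : ℕ) : ℝ) ^ 2 := by
      exact_mod_cast h1.trans (Nat.mul_le_mul_right _ (h h128))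
    calc ((2 * m : ℕ) : ℝ) ^ (Real.logb 2 ((2 * m : ℕ) : ℝ) - 9)
        ≤ ((2 * m : ℕ) : ℝ) ^ (((ℓ + 1 : ℕ) : ℝ) - ((2 : ℕ) : ℝ)) := by
          refine Real.rpow_le_rpow_of_exponent_le hn1 ?_
          have := logb_le_log_add_one hm
          push_cast at this ⊢
          linarith
      _ = ((2 * m : ℕ) : ℝ) ^ (ℓ + 1) / ((2 * m : ℕ) : ℝ) ^ 2 := by
          rw [Real.rpow_sub (by linarith), Real.rpow_natCast, Real.rpow_natCast]
      _ ≤ T := by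
          rw [div_le_iff₀ (by positivity)]
          exact h3
  · refine (Real.rpow_le_one_of_one_le_of_nonpos hn1 ?_).trans (by exact_mod_cast hT)
    have h1 : Real.logb 2 ((2 * m : ℕ) : ℝ) ≤ 8 := by
      rw [Real.logb_le_iff_le_rpow (by norm_num) (by linarith)]
      have : ((2 * m : ℕ) : ℝ) ≤ ((256 : ℕ) : ℝ) := by exact_mod_cast (by omega : 2 * m ≤ 256)
      norm_num at this ⊢
      exact this
    linarith

/-- At logarithmic height the constant factor per level is only polynomial in total: $8^{\ell+1}\le
n^6$. -/
lemma pow_le_rpow_logb_add (hm : 1 ≤ m) :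
    (((2 * (6 * m)) ^ (Nat.log 2 (2 * m) + 1) : ℕ) : ℝ) ≤
      ((2 * m : ℕ) : ℝ) ^ (Real.logb 2 ((2 * m : ℕ) : ℝ) + 9) := by
  have hn1 : (1 : ℝ) ≤ ((2 * m : ℕ) : ℝ) := by exact_mod_cast (by omega : 1 ≤ 2 * m)
  set ℓ := Nat.log 2 (2 * m) with hℓ
  have h2 : 2 ^ ℓ ≤ 2 * m := Nat.pow_log_le_self 2 (by omega)
  have h3 : 8 ^ (ℓ + 1) ≤ (2 * m) ^ 6 := by
    calc 8 ^ (ℓ + 1) = (2 ^ ℓ) ^ 3 * 2 ^ 3 := by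
          rw [pow_succ, show 8 = 2 ^ 3 from rfl, ← pow_mul, ← pow_mul, mul_comm 3]
      _ ≤ (2 * m) ^ 3 * (2 * m) ^ 3 :=
          Nat.mul_le_mul (Nat.pow_le_pow_left h2 3) (Nat.pow_le_pow_left (by omega) 3)
      _ = (2 * m) ^ 6 := by ring
  have h4 : (2 * (6 * m)) ^ (ℓ + 1) ≤ (2 * m) ^ (ℓ + 7) := by
    calc (2 * (6 * m)) ^ (ℓ + 1) ≤ (8 * (2 * m)) ^ (ℓ + 1) := Nat.pow_le_pow_left (by omega) _
      _ = 8 ^ (ℓ + 1) * (2 * m) ^ (ℓ + 1) := mul_pow _ _ _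
      _ ≤ (2 * m) ^ 6 * (2 * m) ^ (ℓ + 1) := Nat.mul_le_mul_right _ h3
      _ = (2 * m) ^ (ℓ + 7) := by rw [← pow_add]; congr 1; omega
  calc (((2 * (6 * m)) ^ (ℓ + 1) : ℕ) : ℝ) ≤ (((2 * m) ^ (ℓ + 7) : ℕ) : ℝ) := by
        exact_mod_cast h4
    _ = ((2 * m : ℕ) : ℝ) ^ ((ℓ + 7 : ℕ) : ℝ) := by rw [Real.rpow_natCast, Nat.cast_pow]
    _ ≤ _ := by
        refine Real.rpow_le_rpow_of_exponent_le hn1 ?_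
        have := log_le_logb hm
        push_cast at this ⊢
        linarith

end Exponents

/-! ## Circuits with oracle calls -/

/-- `OracleCircuit k U`: the operator `U O`, which depends on the oracle `O`, is a product of fixed
unitary operators and of phase oracles for selected queries, with `k` oracle calls in all when a
phase oracle counts as two. -/
inductive OracleCircuit {Q W : Type} [Fintype W] [DecidableEq W] :
    ℕ → ((Q → ZMod 2) → Matrix W W ℂ) → Prop
  | unitary (U : Matrix W W ℂ) (hU : U ∈ Matrix.unitaryGroup W ℂ) : OracleCircuit 0 fun _ => U
  | phase (sel : W → Q) :
      OracleCircuit 2 fun O => Matrix.diagonal fun w => (bitSign (O (sel w)) : ℂ)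
  | mul {k l : ℕ} {U V : (Q → ZMod 2) → Matrix W W ℂ} :
      OracleCircuit k U → OracleCircuit l V → OracleCircuit (k + l) fun O => U O * V O

lemma diagonal_bitSign_conjTranspose {W : Type} [DecidableEq W] (b : W → ZMod 2) :
    (Matrix.diagonal fun w => (bitSign (b w) : ℂ))ᴴ =
      Matrix.diagonal fun w => (bitSign (b w) : ℂ) := by
  rw [Matrix.diagonal_conjTranspose]
  congr 1
  funext w
  simp

lemma diagonal_bitSign_mem_unitaryGroup {W : Type} [Fintype W] [DecidableEq W] (b : W → ZMod 2) :
    (Matrix.diagonal fun w => (bitSign (b w) : ℂ)) ∈ Matrix.unitaryGroup W ℂ := by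
  rw [Matrix.mem_unitaryGroup_iff', Matrix.star_eq_conjTranspose,
    diagonal_bitSign_conjTranspose, Matrix.diagonal_mul_diagonal, ← Matrix.diagonal_one]
  congr 1
  funext w
  exact_mod_cast bitSign_mul_self (b w)

namespace OracleCircuit

variable {Q W W' : Type} [Fintype W] [DecidableEq W] [Fintype W'] [DecidableEq W']
  {k : ℕ} {U : (Q → ZMod 2) → Matrix W W ℂ}

lemma conjTranspose (h : OracleCircuit k U) : OracleCircuit k fun O => (U O)ᴴ := by
  induction h with
  | unitary U hU => exact unitary _ (Unitary.star_mem hU)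
  | phase sel =>
    simp only [diagonal_bitSign_conjTranspose]
    exact phase sel
  | mul _ _ h₁ h₂ =>
    simp only [Matrix.conjTranspose_mul]
    rw [add_comm]
    exact mul h₂ h₁

lemma mem_unitaryGroup (h : OracleCircuit k U) (O : Q → ZMod 2) :
    U O ∈ Matrix.unitaryGroup W ℂ := by
  induction h with
  | unitary U hU => exact hU
  | phase sel => exact diagonal_bitSign_mem_unitaryGroup _
  | mul _ _ h₁ h₂ => exact mul_mem h₁ h₂

lemma submatrix (h : OracleCircuit k U) (e : W' ≃ W) :
    OracleCircuit k fun O => (U O).submatrix e e := by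
  induction h with
  | unitary U hU =>
    refine unitary _ ?_
    rw [Matrix.mem_unitaryGroup_iff', Matrix.star_eq_conjTranspose] at hU ⊢
    rw [Matrix.conjTranspose_submatrix, Matrix.submatrix_mul_equiv, hU,
      Matrix.submatrix_one_equiv]
  | phase sel =>
    simp only [Matrix.submatrix_diagonal_equiv]
    exact phase (sel ∘ e)
  | mul _ _ h₁ h₂ =>
    have := mul h₁ h₂
    simpa only [Matrix.submatrix_mul_equiv] using this

end OracleCircuit

/-! ## From circuits to quantum algorithms -/

section Run

variable {Q W : Type} [Fintype Q] [DecidableEq Q] [Fintype W] [DecidableEq W]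

/-- The state after `k` oracle calls and the unitary that follows, from the initial state `φ`. -/
def runState (u : ℕ → Matrix.unitaryGroup (Q × ZMod 2 × W) ℂ) (O : Q → ZMod 2)
    (φ : Q × ZMod 2 × W → ℂ) : ℕ → (Q × ZMod 2 × W → ℂ)
  | 0 => (u 0).1 *ᵥ φ
  | k + 1 => (u (k + 1)).1 *ᵥ oracleCall O (runState u O φ k)

/-- The state `ψ` of the workspace with the query register `q₀` and the answer bit `0`. -/
def embedState (q₀ : Q) (ψ : W → ℂ) : Q × ZMod 2 × W → ℂ :=
  fun z => if z.1 = q₀ ∧ z.2.1 = 0 then ψ z.2.2 else 0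

omit [Fintype Q] [Fintype W] in
lemma embedState_single (q₀ : Q) (w : W) :
    embedState q₀ (Pi.single w 1) = Pi.single (q₀, 0, w) 1 := by
  funext ⟨q, b, w'⟩
  simp only [embedState, Pi.single_apply, Prod.mk.injEq, ← ite_and, and_assoc]

/-- The last unitary of the first run and the first unitary of the second merge into one, so the
numbers of oracle calls add up. -/
lemma exists_runState_append (u v : ℕ → Matrix.unitaryGroup (Q × ZMod 2 × W) ℂ) (l : ℕ) :
    ∃ w : ℕ → Matrix.unitaryGroup (Q × ZMod 2 × W) ℂ, ∀ O φ k,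
      runState w O φ (l + k) = runState u O (runState v O φ l) k := by
  refine ⟨fun i => (if i < l then 1 else u (i - l)) * (if i ≤ l then v i else 1),
    fun O φ k => ?_⟩
  set w : ℕ → Matrix.unitaryGroup (Q × ZMod 2 × W) ℂ :=
    fun i => (if i < l then 1 else u (i - l)) * (if i ≤ l then v i else 1) with hw
  have hlt : ∀ i < l, w i = v i := fun i hi => by simp [hw, hi, hi.le]
  have heq : w l = u 0 * v l := by simp [hw]
  have hgt : ∀ i, w (l + i + 1) = u (i + 1) := fun i => by
    simp only [hw, if_neg (show ¬ l + i + 1 < l by omega), if_neg (show ¬ l + i + 1 ≤ l by omega),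
      mul_one]
    congr 1
    omega
  have hrun : ∀ i < l, runState w O φ i = runState v O φ i := by
    intro i
    induction i with
    | zero => intro h; rw [runState, runState, hlt 0 h]
    | succ i ih => intro h; rw [runState, runState, hlt _ h, ih (by omega)]
  induction k with
  | zero =>
    cases l with
    | zero => rw [runState, runState, runState, heq, Matrix.mulVec_mulVec]; rfl
    | succ l =>
      rw [add_zero, runState, runState, runState, heq, hrun l (by omega), Matrix.mulVec_mulVec]
      rfl
  | succ k ih => rw [← add_assoc, runState, ih, hgt, runState]

/-- The operator that permutes the basis states. -/
lemma one_submatrix_mem_unitaryGroup (σ : Equiv.Perm W) :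
    (1 : Matrix W W ℂ).submatrix σ id ∈ Matrix.unitaryGroup W ℂ := by
  rw [Matrix.mem_unitaryGroup_iff', Matrix.star_eq_conjTranspose,
    Matrix.conjTranspose_submatrix, Matrix.conjTranspose_one, Matrix.submatrix_mul_equiv, one_mul,
    Matrix.submatrix_id_id]

lemma one_submatrix_mulVec (σ : Equiv.Perm W) (φ : W → ℂ) :
    (1 : Matrix W W ℂ).submatrix σ id *ᵥ φ = φ ∘ σ := by
  funext w
  simp [Matrix.mulVec, dotProduct, Matrix.one_apply]

/-- The permutation of the basis states that exchanges the query `q₀` with the selected query. -/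
def swapQuery (q₀ : Q) (sel : W → Q) : Equiv.Perm (Q × ZMod 2 × W) where
  toFun z := (Equiv.swap q₀ (sel z.2.2) z.1, z.2)
  invFun z := (Equiv.swap q₀ (sel z.2.2) z.1, z.2)
  left_inv z := by simp
  right_inv z := by simp

/-- A phase oracle loads the selected query, calls the oracle, applies the sign of the answer bit,
then calls the oracle again to clear that bit. This is why it counts as two calls. -/
lemma OracleCircuit.exists_runState {k : ℕ} {U : (Q → ZMod 2) → Matrix W W ℂ}
    (h : OracleCircuit k U) (q₀ : Q) :
    ∃ u : ℕ → Matrix.unitaryGroup (Q × ZMod 2 × W) ℂ, ∀ O ψ,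
      runState u O (embedState q₀ ψ) k = embedState q₀ (U O *ᵥ ψ) := by
  induction h with
  | unitary U hU =>
    refine ⟨fun _ => ⟨(1 : Matrix Q Q ℂ) ⊗ₖ ((1 : Matrix (ZMod 2) (ZMod 2) ℂ) ⊗ₖ U),
      Matrix.kronecker_mem_unitary (one_mem _) (Matrix.kronecker_mem_unitary (one_mem _) hU)⟩,
      fun O ψ => ?_⟩
    funext ⟨q, b, w⟩
    simp only [runState, Matrix.mulVec, dotProduct, Fintype.sum_prod_type,
      Matrix.kroneckerMap_apply, Matrix.one_apply, embedState, ite_and, ite_mul, one_mul, zero_mul,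
      mul_ite, mul_zero]
    by_cases hq : q = q₀ <;> by_cases hb : b = 0 <;> simp [hq, hb]
  | phase sel =>
    let P : Matrix.unitaryGroup (Q × ZMod 2 × W) ℂ :=
      ⟨_, one_submatrix_mem_unitaryGroup (swapQuery q₀ sel)⟩
    let Z : Matrix.unitaryGroup (Q × ZMod 2 × W) ℂ :=
      ⟨_, diagonal_bitSign_mem_unitaryGroup fun z => z.2.1⟩
    refine ⟨fun i => if i = 1 then Z else P, fun O ψ => ?_⟩
    have hcc : ∀ x y : ZMod 2, x - y - y = x := by decide
    funext ⟨q, b, w⟩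
    simp only [runState, P, Z, if_true, zero_ne_one, if_false, zero_add, Nat.reduceAdd,
      OfNat.ofNat_ne_one, one_submatrix_mulVec, Function.comp_apply, oracleCall,
      Matrix.mulVec_diagonal]
    simp only [swapQuery, Equiv.coe_fn_mk, Equiv.swap_apply_self, embedState, hcc]
    by_cases hqb : q = q₀ ∧ b = 0
    · obtain ⟨rfl, rfl⟩ := hqb
      simp [Matrix.mulVec_diagonal]
    · simp [hqb]
  | mul h₁ h₂ ih₁ ih₂ =>
    obtain ⟨u, hu⟩ := ih₁
    obtain ⟨v, hv⟩ := ih₂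
    obtain ⟨w, hw⟩ := exists_runState_append u v _
    refine ⟨w, fun O ψ => ?_⟩
    rw [add_comm, hw, hv, hu, Matrix.mulVec_mulVec]

lemma QuantumAlgorithm.state_eq_runState {R : Type} (A : QuantumAlgorithm Q R) (O : Q → ZMod 2)
    (k : ℕ) : A.state O k = runState A.unitary O (Pi.single A.start 1) k := by
  induction k with
  | zero => rfl
  | succ k ih => rw [QuantumAlgorithm.state, ih, runState]

/-- A circuit that maps the basis state `w₀` to basis states gives an exact quantum algorithm. -/
lemma OracleCircuit.exists_quantumAlgorithm {R : Type} [DecidableEq R] [Nonempty Q] {k : ℕ}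
    {U : (Q → ZMod 2) → Matrix W W ℂ} (h : OracleCircuit k U) (w₀ : W) (out : W → R) :
    ∃ A : QuantumAlgorithm Q R, A.queries = k ∧ ∀ O w,
      U O *ᵥ Pi.single w₀ 1 = Pi.single w 1 → A.prob O (out w) = 1 := by
  obtain ⟨q₀⟩ := ‹Nonempty Q›
  obtain ⟨u, hu⟩ := h.exists_runState q₀
  refine ⟨{ Work := W, queries := k, start := (q₀, 0, w₀), unitary := u,
            out := fun z => out z.2.2 }, rfl, fun O w hw => ?_⟩
  rw [QuantumAlgorithm.prob]
  simp only [QuantumAlgorithm.state_eq_runState]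
  rw [← embedState_single, hu, hw, embedState_single, Finset.sum_eq_single (q₀, 0, w)]
  · simp
  · intro z _ hz
    simp [hz]
  · simp

end Run

/-! ## The quantum algorithm for the hidden shift problem -/

section Hadamard

variable {m : ℕ}

/-- The normalized Walsh–Hadamard transform. -/
def hadamard (m : ℕ) (v : DoubleCube m → ℝ) (w : DoubleCube m) : ℝ :=
  (2 ^ m)⁻¹ * ∑ x, bitSign (w ⬝ᵥ x) * v x

lemma hadamard_single_zero : hadamard m (Pi.single 0 1) = fun _ => (2 ^ m)⁻¹ := by
  funext w
  simp [hadamard, Pi.single_apply, bitSign_zero]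

lemma sum_bitSign_mul_bitSign (y s : DoubleCube m) :
    (2 ^ m : ℝ)⁻¹ * (2 ^ m)⁻¹ * ∑ x, bitSign (y ⬝ᵥ x) * bitSign (x ⬝ᵥ s) =
      if y = s then 1 else 0 := by
  have h : ∀ x : DoubleCube m, bitSign (y ⬝ᵥ x) * bitSign (x ⬝ᵥ s) = bitSign ((y + s) ⬝ᵥ x) := by
    intro x
    rw [← bitSign_add, add_dotProduct, dotProduct_comm x s]
  simp only [h, sum_bitSign_dotProduct, cube_add_eq_zero, Fintype.card_sum, Fintype.card_fin,
    pow_add]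
  split_ifs
  · field_simp
  · simp

lemma hadamard_character (s : DoubleCube m) :
    hadamard m (fun w => (2 ^ m)⁻¹ * bitSign (w ⬝ᵥ s)) = Pi.single s 1 := by
  funext y
  rw [Pi.single_apply, ← sum_bitSign_mul_bitSign, hadamard]
  simp only [Finset.mul_sum]
  exact Finset.sum_congr rfl fun x _ => by ring

/-- A translation by $s$ becomes multiplication by the character of $s$, and bentness leaves only
signs otherwise. Once the sign of the dual is removed, a last transform turns the character into the
basis state $s$. -/
lemma hadamard_shifted {f fd : DoubleCube m → ZMod 2} (hf : IsBentWithDual f fd)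
    (s w : DoubleCube m) :
    hadamard m (fun x => bitSign (f (x + s)) * (2 ^ m)⁻¹) w =
      (2 ^ m)⁻¹ * bitSign (w ⬝ᵥ s) * bitSign (fd w) := by
  have hss : s + s = 0 := cube_add_eq_zero.2 rfl
  have h1 : ∑ x, bitSign (w ⬝ᵥ x) * (bitSign (f (x + s)) * (2 ^ m : ℝ)⁻¹) =
      bitSign (w ⬝ᵥ s) * (2 ^ m)⁻¹ * ∑ x, bitSign (w ⬝ᵥ x + f x) := by
    rw [← Equiv.sum_comp (Equiv.addRight s), Finset.mul_sum]
    refine Finset.sum_congr rfl fun x _ => ?_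
    rw [Equiv.coe_addRight, add_assoc, hss, add_zero, dotProduct_add, bitSign_add, bitSign_add]
    ring
  rw [hadamard, h1, ← walshCoeff_of_dual hf (k := m) (by simp; ring), walshCoeff]
  simp only [Fintype.card_sum, Fintype.card_fin, pow_add]
  field_simp

/-- The matrix of the Walsh–Hadamard transform. -/
def hadamardMatrix (m : ℕ) : Matrix (DoubleCube m) (DoubleCube m) ℂ :=
  Matrix.of fun w x => (((2 ^ m)⁻¹ * bitSign (w ⬝ᵥ x) : ℝ) : ℂ)

lemma hadamardMatrix_mem_unitaryGroup :
    hadamardMatrix m ∈ Matrix.unitaryGroup (DoubleCube m) ℂ := by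
  rw [Matrix.mem_unitaryGroup_iff]
  ext y s
  rw [Matrix.mul_apply, Matrix.one_apply]
  have h : ∀ x, hadamardMatrix m y x * star (hadamardMatrix m) x s =
      (((2 ^ m : ℝ)⁻¹ * (2 ^ m)⁻¹ * (bitSign (y ⬝ᵥ x) * bitSign (x ⬝ᵥ s)) : ℝ) : ℂ) := by
    intro x
    simp only [hadamardMatrix, Matrix.star_apply, Matrix.of_apply, RCLike.star_def,
      Complex.conj_ofReal, dotProduct_comm s x]
    push_cast
    ring
  rw [Finset.sum_congr rfl fun x _ => h x, ← Complex.ofReal_sum, ← Finset.mul_sum,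
    sum_bitSign_mul_bitSign]
  split_ifs <;> simp

end Hadamard

section Registers

variable {m : ℕ} {C A : Type} [Fintype C] [DecidableEq C] [Fintype A] [DecidableEq A]

/-- The state of three registers with the value `c` in the first, the amplitudes `v` in the second
and a function `a` of the second register in the third. -/
def registerState (c : C) (v : DoubleCube m → ℝ) (a : DoubleCube m → A) :
    C × DoubleCube m × A → ℂ :=
  fun z => if z.1 = c ∧ z.2.2 = a z.2.1 then (v z.2.1 : ℂ) else 0

omit [Fintype C] [Fintype A] in
lemma registerState_single (c : C) (x : DoubleCube m) (a : DoubleCube m → A) :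
    registerState c (Pi.single x 1) a = Pi.single (c, x, a x) 1 := by
  funext ⟨c', y, a'⟩
  simp only [registerState, Pi.single_apply, Prod.mk.injEq]
  by_cases hy : y = x
  · subst hy
    simp
  · simp [hy]

omit [Fintype C] [Fintype A] in
lemma registerState_eq_sum (c : C) (v : DoubleCube m → ℝ) (a : DoubleCube m → A) :
    registerState c v a = ∑ x, (v x : ℂ) • Pi.single (c, x, a x) (1 : ℂ) := by
  funext ⟨c', y, a'⟩
  simp only [registerState, Finset.sum_apply, Pi.smul_apply, Pi.single_apply, Prod.mk.injEq,
    smul_eq_mul, mul_ite, mul_one, mul_zero]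
  rw [Finset.sum_eq_single y]
  · simp
  · intro x _ hx
    simp [hx.symm]
  · simp

lemma diagonal_mulVec_registerState (d : C × DoubleCube m × A → ZMod 2) (c : C)
    (v : DoubleCube m → ℝ) (a : DoubleCube m → A) :
    (Matrix.diagonal fun z => (bitSign (d z) : ℂ)) *ᵥ registerState c v a =
      registerState c (fun x => bitSign (d (c, x, a x)) * v x) a := by
  funext ⟨c', y, a'⟩
  rw [Matrix.mulVec_diagonal]
  simp only [registerState]
  split_ifs with h
  · obtain ⟨rfl, rfl⟩ := h
    push_cast
    rfl
  · simp

/-- The Walsh–Hadamard transform of the second register. -/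
def hadamardLift (m : ℕ) (C A : Type) [DecidableEq C] [DecidableEq A] :
    Matrix (C × DoubleCube m × A) (C × DoubleCube m × A) ℂ :=
  (1 : Matrix C C ℂ) ⊗ₖ (hadamardMatrix m ⊗ₖ (1 : Matrix A A ℂ))

lemma hadamardLift_mem_unitaryGroup :
    hadamardLift m C A ∈ Matrix.unitaryGroup (C × DoubleCube m × A) ℂ :=
  Matrix.kronecker_mem_unitary (one_mem _)
    (Matrix.kronecker_mem_unitary hadamardMatrix_mem_unitaryGroup (one_mem _))

lemma hadamardLift_mulVec_registerState (c : C) (v : DoubleCube m → ℝ) (a : A) :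
    hadamardLift m C A *ᵥ registerState c v (fun _ => a) =
      registerState c (hadamard m v) fun _ => a := by
  funext ⟨c', y, a'⟩
  simp only [hadamardLift, Matrix.mulVec, dotProduct, Fintype.sum_prod_type,
    Matrix.kroneckerMap_apply, Matrix.one_apply, registerState, hadamardMatrix, Matrix.of_apply,
    hadamard, ite_and, ite_mul, one_mul, zero_mul, mul_ite, mul_zero, mul_one]
  by_cases hc : c' = c <;> by_cases ha : a' = a <;>
    simp [hc, ha, Finset.mul_sum, mul_assoc]

/-- The hidden shift algorithm, for any implementation `P` of the phase oracle of the shifted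
function. -/
lemma exists_shift_circuit {Q : Type} {k : ℕ}
    {P : (Q → ZMod 2) → Matrix (C × DoubleCube m × A) (C × DoubleCube m × A) ℂ}
    (hP : OracleCircuit k P) (sel : C × DoubleCube m × A → Q) (a₀ : A) :
    ∃ U, OracleCircuit (k + 2) U ∧
      ∀ (f fd : DoubleCube m → ZMod 2), IsBentWithDual f fd → ∀ O c s,
        (∀ v, P O *ᵥ registerState c v (fun _ => a₀) =
          registerState c (fun x => bitSign (f (x + s)) * v x) fun _ => a₀) →
        (∀ x, O (sel (c, x, a₀)) = fd x) →
        U O *ᵥ Pi.single (c, 0, a₀) 1 = Pi.single (c, s, a₀) 1 := by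
  have hH : OracleCircuit (Q := Q) 0 fun _ => hadamardLift m C A :=
    .unitary _ hadamardLift_mem_unitaryGroup
  have hU := hH.mul ((OracleCircuit.phase sel).mul (hH.mul (hP.mul hH)))
  refine ⟨_, by convert hU using 1; omega, fun f fd hf O c s hPs hsel => ?_⟩
  simp only [← Matrix.mulVec_mulVec]
  rw [← registerState_single c 0 (fun _ => a₀), hadamardLift_mulVec_registerState,
    hadamard_single_zero, hPs, hadamardLift_mulVec_registerState, diagonal_mulVec_registerState,
    hadamardLift_mulVec_registerState]
  have h : (fun x => bitSign (O (sel (c, x, a₀))) *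
      hadamard m (fun x => bitSign (f (x + s)) * (2 ^ m)⁻¹) x) =
      fun w => (2 ^ m : ℝ)⁻¹ * bitSign (w ⬝ᵥ s) := by
    funext x
    rw [hsel, hadamard_shifted hf, mul_comm, mul_assoc, bitSign_mul_self, mul_one]
  rw [h, hadamard_character, registerState_single]

end Registers

/-- The recursive algorithm: it computes the key of a superposition of queries to the shifted
function, calls the oracle and uncomputes the key. The queries are embedded in a larger query set
by `e`, controlled by a register in `C`. -/
lemma exists_root_circuit (m ℓ : ℕ) :
    ∃ (A : Type) (_ : Fintype A) (_ : DecidableEq A) (a₀ : A),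
      ∀ (Q C : Type) [Fintype C] [DecidableEq C] (e : C → RecQuery (DoubleCube m) ℓ → Q),
        ∃ (k : ℕ) (U : (Q → ZMod 2) →
            Matrix (C × DoubleCube m × A) (C × DoubleCube m × A) ℂ),
          k + 4 ≤ 8 * 2 ^ ℓ ∧ OracleCircuit k U ∧
          ∀ f fd : DoubleCube m → ZMod 2, IsBentWithDual f fd → ∀ O c S,
            (∀ q, O (e c q) = recOracle f fd ℓ S q) →
            U O *ᵥ Pi.single (c, 0, a₀) 1 = Pi.single (c, ShiftTree.root ℓ S, a₀) 1 := by
  induction ℓ with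
  | zero =>
    refine ⟨Unit, inferInstance, inferInstance, (), fun Q C _ _ e => ?_⟩
    obtain ⟨U, hU, hspec⟩ := exists_shift_circuit (m := m)
      (OracleCircuit.phase fun z : C × DoubleCube m × Unit => e z.1 (ShiftQuery.shifted z.2.1))
      (fun z => e z.1 (ShiftQuery.dual z.2.1)) ()
    refine ⟨_, U, by norm_num, hU, fun f fd hf O c S hO => hspec f fd hf O c S (fun v => ?_)
      fun x => hO (ShiftQuery.dual x)⟩
    rw [diagonal_mulVec_registerState (fun z => O (e z.1 (ShiftQuery.shifted z.2.1)))]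
    congr 1
    funext x
    rw [hO (ShiftQuery.shifted x)]
    rfl
  | succ ℓ ih =>
    obtain ⟨A, _, _, a₀, hA⟩ := ih
    refine ⟨DoubleCube m × A, inferInstance, inferInstance, (0, a₀), fun Q C _ _ e => ?_⟩
    obtain ⟨k, K, hk, hK, hspec⟩ := hA Q (C × DoubleCube m) fun z q => e z.1 (.inr (z.2, q))
    let r := (Equiv.prodAssoc C (DoubleCube m) (DoubleCube m × A)).symm
    have hK' := hK.submatrix r
    obtain ⟨sel, hsel⟩ : ∃ sel : C × DoubleCube m × DoubleCube m × A → Q, ∀ c x key a,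
        sel (c, x, key, a) = e c (.inl (.shifted x, key)) :=
      ⟨fun z => e z.1 (.inl (.shifted z.2.1, z.2.2.1)), fun _ _ _ _ => rfl⟩
    obtain ⟨U, hU, hUspec⟩ := exists_shift_circuit
      (hK'.conjTranspose.mul ((OracleCircuit.phase sel).mul hK'))
      (fun z => e z.1 (.inl (.dual z.2.1, 0))) (0, a₀)
    -- The new count is $2k+4$, so $k+4$ exactly doubles with the height.
    refine ⟨_, U, by rw [pow_succ]; omega, hU, fun f fd hf O c S hO => ?_⟩
    refine hUspec f fd hf O c S.1 (fun v => ?_) fun x => hO (.inl (.dual x, 0))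
    -- The query $x$ joins the control register of the smaller circuit, whose output register then
    -- holds the key. The action on basis states extends to superpositions by linearity.
    have hkey : ∀ v, (K O).submatrix r r *ᵥ registerState c v (fun _ => (0, a₀)) =
        registerState c v fun x => (ShiftTree.root ℓ (S.2 x), a₀) := by
      intro v
      rw [registerState_eq_sum, registerState_eq_sum, Matrix.mulVec_sum]
      refine Finset.sum_congr rfl fun x _ => ?_
      rw [Matrix.mulVec_smul, Matrix.submatrix_mulVec_equiv]
      have h1 : ∀ y : DoubleCube m × A, (Pi.single (c, x, y) (1 : ℂ)) ∘ r.symm =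
          Pi.single ((c, x), y) 1 := by
        intro y
        funext ⟨⟨c', x'⟩, y'⟩
        simp [r, Pi.single_apply, and_assoc]
      have h2 : ∀ y : DoubleCube m × A, (Pi.single ((c, x), y) (1 : ℂ)) ∘ r =
          Pi.single (c, x, y) 1 := by
        intro y
        funext ⟨c', x', y'⟩
        simp [r, Pi.single_apply, and_assoc]
      rw [h1, hspec f fd hf O (c, x) (S.2 x) fun q => hO (.inr (x, q)), h2]
    -- The phase changes only the amplitudes, so the state is still the image of a state with
    -- cleared key register, and the adjoint circuit restores that state exactly.
    rw [← Matrix.mulVec_mulVec, ← Matrix.mulVec_mulVec, hkey, diagonal_mulVec_registerState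
      (fun z => O (sel z)), ← hkey, Matrix.mulVec_mulVec,
      ← Matrix.star_eq_conjTranspose,
      Matrix.mem_unitaryGroup_iff'.1 (hK'.mem_unitaryGroup O), Matrix.one_mulVec]
    congr 1
    funext x
    rw [hsel, hO (.inl (.shifted x, ShiftTree.root ℓ (S.2 x)))]
    exact congrArg (fun b => bitSign b * v x) (if_pos rfl)

/-! ## The main theorem -/

lemma RecQuery.nonempty {V : Type} [Nonempty V] : (ℓ : ℕ) → Nonempty (RecQuery V ℓ)
  | 0 => ‹Nonempty V›.map ShiftQuery.base
  | _ + 1 => ‹Nonempty V›.map fun x => Sum.inl (.base x, x)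

lemma ShiftTree.exists_root {V : Type} [Nonempty V] (ℓ : ℕ) (s : V) :
    ∃ S : ShiftTree V ℓ, ShiftTree.root ℓ S = s := by
  cases ℓ with
  | zero => exact ⟨s, rfl⟩
  | succ ℓ => exact ⟨(s, fun _ => Classical.arbitrary _), rfl⟩

theorem theorem3 :
    -- the hidden shift problem with access to the dual has classical query complexity `Θ(n)`
    (∃ c C : ℝ, 0 < c ∧ 0 < C ∧ ∀ m : ℕ, 1 ≤ m →
      -- necessary: for every single `f`, even when `f` is known and the algorithm may err
      (∀ f fd : DoubleCube m → ZMod 2, IsMaioranaMcFarland f → IsBentWithDual f fd →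
        ∀ (μ : PMF (DecisionTree (ShiftQuery (DoubleCube m)) (DoubleCube m))) (T : ℕ),
          RandomizedSolves μ (fun s => shiftOracle f fd s) (fun s => s) T →
            c * ((2 * m : ℕ) : ℝ) ≤ T) ∧
      -- sufficient: an algorithm that depends on `f` only through `π⁻¹(e₁), …, π⁻¹(eₘ)`
      (∀ b : Fin m → Cube (Fin m),
        ∃ (t : DecisionTree (ShiftQuery (DoubleCube m)) (DoubleCube m)) (T : ℕ),
          (T : ℝ) ≤ C * ((2 * m : ℕ) : ℝ) ∧
          ∀ (π : Equiv.Perm (Cube (Fin m))) (h : Cube (Fin m) → ZMod 2)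
            (fd : DoubleCube m → ZMod 2),
            (∀ i, π.symm (Pi.single i 1) = b i) → IsBentWithDual (maioranaMcFarland π h) fd →
              t.Solves (fun s => shiftOracle (maioranaMcFarland π h) fd s) (fun s => s) T)) ∧
    -- the recursive oracle of height `⌊log₂ n⌋`
    (∃ k : ℕ, ∃ C : ℝ, ∀ m : ℕ, 1 ≤ m →
      -- quantum: polynomially many queries, no error, `f` not known to the algorithm
      (∃ A : QuantumAlgorithm (RecQuery (DoubleCube m) (Nat.log 2 (2 * m))) (DoubleCube m),
        A.queries ≤ (2 * m) ^ k ∧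
        ∀ f fd : DoubleCube m → ZMod 2, IsMaioranaMcFarland f → IsBentWithDual f fd →
          ∀ S : ShiftTree (DoubleCube m) (Nat.log 2 (2 * m)),
            A.prob (recOracle f fd _ S) (ShiftTree.root _ S) = 1) ∧
      -- classical: `n ^ (log₂ n ± O(1))` queries, for every single `f`
      (∀ f fd : DoubleCube m → ZMod 2, IsMaioranaMcFarland f → IsBentWithDual f fd →
        (∀ (μ : PMF (DecisionTree (RecQuery (DoubleCube m) (Nat.log 2 (2 * m))) (DoubleCube m)))
          (T : ℕ), RandomizedSolves μ (recOracle f fd _) (ShiftTree.root _) T →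
            ((2 * m : ℕ) : ℝ) ^ (Real.logb 2 ((2 * m : ℕ) : ℝ) - C) ≤ T) ∧
        (∃ (t : DecisionTree (RecQuery (DoubleCube m) (Nat.log 2 (2 * m))) (DoubleCube m))
          (T : ℕ), t.Solves (recOracle f fd _) (ShiftTree.root _) T ∧
            (T : ℝ) ≤ ((2 * m : ℕ) : ℝ) ^ (Real.logb 2 ((2 * m : ℕ) : ℝ) + C)))) := by
  have hV : ∀ m : ℕ, Fintype.card (DoubleCube m) = 2 ^ (2 * m) := fun m => by
    rw [card_cube, Fintype.card_sum, Fintype.card_fin, two_mul]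
  refine ⟨⟨1 / 2, 3, by norm_num, by norm_num, fun m hm => ⟨?_, fun b => ?_⟩⟩,
    4, 9, fun m hm => ⟨?_, ?_⟩⟩
  · intro f fd _ _ μ T h
    have hT : (m : ℝ) ≤ T := by exact_mod_cast h.le_of_shiftOracle hm (hV m)
    push_cast
    linarith
  · refine ⟨findShift b, 6 * m, ?_, fun π h fd hb hfd => findShift_solves hb hfd⟩
    push_cast
    linarith
  · obtain ⟨A, _, _, a₀, hA⟩ := exists_root_circuit m (Nat.log 2 (2 * m))
    obtain ⟨k, U, hk, hU, hspec⟩ :=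
      hA (RecQuery (DoubleCube m) (Nat.log 2 (2 * m))) Unit fun _ q => q
    have := RecQuery.nonempty (V := DoubleCube m) (Nat.log 2 (2 * m))
    obtain ⟨B, hB, hprob⟩ := hU.exists_quantumAlgorithm ((), 0, a₀) fun z => z.2.1
    refine ⟨B, ?_, fun f fd _ hfd S => ?_⟩
    · have h1 : 2 ^ Nat.log 2 (2 * m) ≤ 2 * m := Nat.pow_log_le_self 2 (by omega)
      have h2 : 2 ^ 3 ≤ (2 * m) ^ 3 := Nat.pow_le_pow_left (by omega) 3
      calc B.queries ≤ 8 * 2 ^ Nat.log 2 (2 * m) := by omega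
        _ ≤ (2 * m) ^ 3 * (2 * m) := Nat.mul_le_mul h2 h1
        _ = (2 * m) ^ 4 := by ring
    · exact hprob (recOracle f fd _ S) ((), ShiftTree.root _ S, a₀)
        (hspec f fd hfd (recOracle f fd _ S) () S fun _ => rfl)
  · intro f fd hf hfd
    constructor
    · intro μ T h
      have hne : (0 : DoubleCube m) ≠ 1 := fun h0 => by
        have := congrFun h0 (Sum.inl ⟨0, hm⟩)
        simp at this
      obtain ⟨S₀, hS₀⟩ := ShiftTree.exists_root (Nat.log 2 (2 * m)) (0 : DoubleCube m)
      obtain ⟨S₁, hS₁⟩ := ShiftTree.exists_root (Nat.log 2 (2 * m)) (1 : DoubleCube m)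
      exact rpow_logb_sub_le hm (h.one_le (i := S₀) (j := S₁) (by rwa [hS₀, hS₁]))
        fun h128 => h.pow_log_le h128 (hV m)
    · obtain ⟨π, h, rfl⟩ := hf
      exact ⟨_, _, findRoot_solves (by omega) (findShift_solves (fun _ => rfl) hfd) _,
        pow_le_rpow_logb_add hm⟩

end
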